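/- Let $X$ be a complex Banach space and let $T\in B(X)$ be a Ritt operator, i.e. the sets $\{T^n: n\ge 0\}$ and $\{n(T^n-T^{n-1}): n\ge 1\}$ are bounded. Put $A=I-T$, and write $R(z,S)=(zI-S)^{-1}$ for the resolvent of $S \in B(X)$. For $\omega\in(0,\pi)$ let $\Sigma_\omega=\{z\in\mathbb C\setminus\{0\}: |\mathrm{Arg}\, z|<\omega\}$, and for $\gamma\in(0,\frac{\pi}{2})$ let $B_\gamma$ be the interior of the convex hull of $1$ and the disc $D(0,\sin\gamma)$. The operator $A$ is sectorial of type $\omega$ if $\sigma(A)\subset\overline{\Sigma_\omega}$ and $\{zR(z,A): z\notin\overline{\Sigma_\nu}\}$ is bounded for every $\nu\in(\omega,\pi)$. The operator $T$ is a Ritt operator of type $\alpha\in(0,\frac{\pi}{2})$ if $\sigma(T)\subset\overline{B_\alpha}$ and $\{(\lambda-1)R(\lambda,T): \lambda\notin\overline{B_\beta}\}$ is bounded for every $\beta\in(\alpha,\frac{\pi}{2})$. Let $H^\infty_0(\Sigma_\theta)$ be the set of bounded holomorphic $f\colon\Sigma_\theta\to\mathbb C$ such that $|f(z)|\le c\,|z|^s/(1+|z|^{2s})$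 on $\Sigma_\theta$ for some $c,s>0$, and let $H^\infty_0(B_\gamma)$ be the set of bounded holomorphic $\varphi\colon B_\gamma\to\mathbb C$ such that $|\varphi(\lambda)|\le c\,|1-\lambda|^s$ on $B_\gamma$ for some $c,s>0$. We say that $A$ admits a bounded $H^\infty(\Sigma_\theta)$ functional calculus if $A$ is sectorial of some type $\omega\in(0,\theta)$ and there is a constant $K>0$ such that $\|f(A)\|\le K\sup_{\Sigma_\theta}|f|$ for all $f\in H_0^\infty(\Sigma_\theta)$, where $$f(A)=\frac1{2\pi i}\int_{\partial\Sigma_\nu}f(z)R(z,A)\,dz,\qquad \nu\in(\omega,\theta).$$ We say that $T$ admits a bounded $H^\infty(B_\gamma)$ functional calculus if $T$ is a Ritt operator of some type $\alpha\in(0,\gamma)$ and there is a constant $K>0$ such that $\|\varphi(T)\|\le K\sup_{B_\gamma}|\varphi|$ for all $\varphi\in H_0^\infty(B_\gamma)$, where $$\varphi(T)=\frac1{2\pi i}\int_{\partial B_\beta}\varphi(\lambda)R(\lambda,T)\,d\lambda,\qquad \beta\in(\alpha,\gamma).$$ Both boundaries are oriented counterclockwise, and the integrals do not depend on the choice of $\nu$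 and $\beta$. Then the following are equivalent: (i) $T$ admits a bounded $H^\infty(B_\gamma)$ functional calculus for some $\gamma\in(0,\frac{\pi}{2})$; (ii) $A$ admits a bounded $H^\infty(\Sigma_\theta)$ functional calculus for some $\theta\in(0,\frac{\pi}{2})$. -/

import Mathlib

noncomputable section

namespace RittCalculus

open MeasureTheory Set

/-- The open sector `Σ_ω = {z ≠ 0 : |Arg z| < ω}`. -/
def sector (ω : ℝ) : Set ℂ := {z | z ≠ 0 ∧ |Complex.arg z| < ω}

/-- The Stolz domain `B_γ`: the interior of the convex hull of `1` and the disc `D(0, sin γ)`. -/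
def stolz (γ : ℝ) : Set ℂ :=
  interior (convexHull ℝ (insert (1 : ℂ) (Metric.ball (0 : ℂ) (Real.sin γ))))

/-- `f` restricts to an element of `H^∞(Ω)`: a bounded holomorphic function on `Ω`. -/
def IsHInfty (Ω : Set ℂ) (f : ℂ → ℂ) : Prop :=
  DifferentiableOn ℂ f Ω ∧ ∃ M : ℝ, ∀ z ∈ Ω, ‖f z‖ ≤ M

/-- The supremum norm of `f` over `Ω`. -/
def supNorm (Ω : Set ℂ) (f : ℂ → ℂ) : ℝ := ⨆ z : Ω, ‖f z‖

/-- `f` restricts to an element of `H^∞_0(Σ_θ)`. -/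
def IsHInftyZeroSector (θ : ℝ) (f : ℂ → ℂ) : Prop :=
  IsHInfty (sector θ) f ∧
    ∃ s c : ℝ, 0 < s ∧ 0 < c ∧ ∀ z ∈ sector θ, ‖f z‖ ≤ c * (‖z‖ ^ s / (1 + ‖z‖ ^ (2 * s)))

/-- `φ` restricts to an element of `H^∞_0(B_γ)`. -/
def IsHInftyZeroStolz (γ : ℝ) (φ : ℂ → ℂ) : Prop :=
  IsHInfty (stolz γ) φ ∧
    ∃ s c : ℝ, 0 < s ∧ 0 < c ∧ ∀ z ∈ stolz γ, ‖φ z‖ ≤ c * ‖1 - z‖ ^ s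

variable {X : Type*} [NormedAddCommGroup X] [NormedSpace ℂ X]

/-- Ritt operators: `{T^n : n ≥ 0}` and `{n (T^n - T^(n-1)) : n ≥ 1}` are bounded. -/
def IsRitt (T : X →L[ℂ] X) : Prop :=
  (∃ C : ℝ, ∀ n : ℕ, ‖T ^ n‖ ≤ C) ∧
    ∃ C : ℝ, ∀ n : ℕ, 1 ≤ n → ‖(n : ℂ) • (T ^ n - T ^ (n - 1))‖ ≤ C

/-- Ritt operators of type `α`. Here `resolvent T z = (z I - T)⁻¹`. -/
def IsRittOfType (T : X →L[ℂ] X) (α : ℝ) : Prop :=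
  spectrum ℂ T ⊆ closure (stolz α) ∧
    ∀ β ∈ Ioo α (Real.pi / 2), ∃ C : ℝ,
      ∀ z ∉ closure (stolz β), ‖(z - 1) • resolvent T z‖ ≤ C

/-- Sectorial operators of type `ω`, for an everywhere defined bounded operator `A`
(which is automatically closed and densely defined). -/
def IsSectorialOfType (A : X →L[ℂ] X) (ω : ℝ) : Prop :=
  spectrum ℂ A ⊆ closure (sector ω) ∧
    ∀ ν ∈ Ioo ω Real.pi, ∃ C : ℝ,
      ∀ z ∉ closure (sector ν), ‖z • resolvent A z‖ ≤ C

/-- `(1 / 2πi) ∫_{∂Σ_ν} f(z) R(z, A) dz`, the boundary being oriented counterclockwise: outwards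
along the ray `t e^{-iν}`, inwards along the ray `t e^{iν}`. -/
def sectorIntegral (A : X →L[ℂ] X) (ν : ℝ) (f : ℂ → ℂ) : X →L[ℂ] X :=
  let w : ℂ := Complex.exp (ν * Complex.I)
  let w' : ℂ := Complex.exp (-(ν * Complex.I))
  (2 * Real.pi * Complex.I : ℂ)⁻¹ •
    ((∫ t : ℝ in Ioi 0, (w' * f (t * w')) • resolvent A (t * w')) -
      ∫ t : ℝ in Ioi 0, (w * f (t * w)) • resolvent A (t * w))

/-- `(1 / 2πi) ∫_{∂B_β} φ(z) R(z, T) dz`, the boundary being oriented counterclockwise: the segment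
`1 - t e^{-iβ}` from `1` (`t = 0`) to the point of tangency `1 - cos β e^{-iβ} = sin β e^{i(π/2-β)}`,
the arc of the circle of radius `sin β` around `0` from the angle `π/2 - β` to the angle
`3π/2 + β`, and the segment `1 - t e^{iβ}` from `t = cos β` back to `1`. -/
def stolzIntegral (T : X →L[ℂ] X) (β : ℝ) (φ : ℂ → ℂ) : X →L[ℂ] X :=
  let w : ℂ := Complex.exp (β * Complex.I)
  let w' : ℂ := Complex.exp (-(β * Complex.I))
  let arc : ℝ → ℂ := fun t => Real.sin β * Complex.exp (t * Complex.I)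
  (2 * Real.pi * Complex.I : ℂ)⁻¹ •
    ((∫ t in (0 : ℝ)..Real.cos β, (-w' * φ (1 - t * w')) • resolvent T (1 - t * w')) +
      (∫ t in (Real.pi / 2 - β)..(3 * Real.pi / 2 + β),
        (Complex.I * arc t * φ (arc t)) • resolvent T (arc t)) +
      ∫ t in (Real.cos β)..(0 : ℝ), (-w * φ (1 - t * w)) • resolvent T (1 - t * w))

/-- `A` is sectorial of some type `ω ∈ (0, θ)` and admits a bounded `H^∞(Σ_θ)` functional calculus:
`‖f(A)‖ ≤ K ‖f‖` for all `f ∈ H^∞_0(Σ_θ)`. The operator `f(A)` is the integral along `∂Σ_ν` for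
any `ν ∈ (ω, θ)` (by Cauchy's theorem these integrals agree). -/
def HasBoundedSectorCalculus (A : X →L[ℂ] X) (θ : ℝ) : Prop :=
  ∃ ω ∈ Ioo 0 θ, IsSectorialOfType A ω ∧
    ∃ K : ℝ, 0 < K ∧ ∀ f : ℂ → ℂ, IsHInftyZeroSector θ f →
      ∀ ν ∈ Ioo ω θ, ‖sectorIntegral A ν f‖ ≤ K * supNorm (sector θ) f

/-- `T` is a Ritt operator of some type `α ∈ (0, γ)` and admits a bounded `H^∞(B_γ)` functional
calculus: `‖φ(T)‖ ≤ K ‖φ‖` for all `φ ∈ H^∞_0(B_γ)`. The operator `φ(T)` is the integral along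
`∂B_β` for any `β ∈ (α, γ)` (by Cauchy's theorem these integrals agree). -/
def HasBoundedStolzCalculus (T : X →L[ℂ] X) (γ : ℝ) : Prop :=
  ∃ α ∈ Ioo 0 γ, IsRittOfType T α ∧
    ∃ K : ℝ, 0 < K ∧ ∀ φ : ℂ → ℂ, IsHInftyZeroStolz γ φ →
      ∀ β ∈ Ioo α γ, ‖stolzIntegral T β φ‖ ≤ K * supNorm (stolz γ) φ

end RittCalculus

end

/-!
Both directions compare contour integrals of the resolvent of `A = 1 - T`, using
`R(1 - z, T) = -R(z, A)`; the segments of the Stolz contour are thereby initial pieces of the rays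
of the sector contour.

The substitution `φ(λ) = f(1 - λ)` settles the passage from `T` to `A`, because
`1 - B_γ ⊆ Σ_γ`. That `f(A) = φ(T)` (`sectorIntegral_eq_stolzIntegral`) is Cauchy's theorem for the
region between the two contours. This region is star-shaped about infinity, so the integrand has
the explicit primitive `-∫ F(tz) z dt` over `1 < t` (`hasDerivAt_integral_ray_Ioi_one`), and
no theory of contours is needed.

For the passage from `A` to `T`, the Ritt condition and the sectoriality of `A` give the resolvent
estimates for `T` outside a Stolz domain (`IsRitt.exists_stolz_bound`). The part of `φ(T)` coming
from the arc is bounded by `sup |φ|`, since the arc stays away from the spectrum. On the segments,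
with `ζ = 1 - λ` and `g(ζ) = φ(1 - ζ)`, write
`R(ζ, A) = (R(ζ, A) + R(-ζ, A)) - R(-ζ, A)`.

* The function `g(ζ) R(-ζ, A)` is holomorphic inside the whole contour, so that its integral over
  the segments is that over a chord away from `0`, hence bounded by `sup |φ|`
  (`norm_segment_sub_le`).
* `R(ζ, A) + R(-ζ, A)` is the value at `A` of the kernel
  `(ζ - z)⁻¹ - (ζ + z)⁻¹ = 2z / (ζ² - z²)` (`sectorIntegral_kernel`). By Fubini's theorem the
  first part is therefore `f(A)`, where `f` is the integral of `g(ζ) 2z / (ζ² - z²)` over the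
  segments (`IsRayDensity.sectorIntegral_rayTransform`). For `ζ` on a ray outside `Σ_θ` this kernel
  is dominated by the Poisson kernel `|z| / (|ζ|² + |z|²)`, whose integral over the ray is bounded
  independently of `z`; hence `f` lies in `H^∞_0(Σ_θ)` with `sup |f| ≤ C sup |φ|`
  (`IsRayDensity.norm_rayTransform_le`), and the calculus of `A` applies to `f`.
-/

namespace RittCalculus

open MeasureTheory Set Filter Topology

/-! ### Sectors and arguments -/

theorem re_mul_sin_sub_abs_im_mul_cos (z : ℂ) (ω : ℝ) :
    z.re * Real.sin ω - |z.im| * Real.cos ω = ‖z‖ * Real.sin (ω - |z.arg|) := by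
  have h1 : |z.im| = ‖z‖ * Real.sin |z.arg| := by
    rw [← Complex.norm_mul_sin_arg, abs_mul, abs_norm, Real.abs_sin_eq_sin_abs_of_abs_le_pi
      (Complex.abs_arg_le_pi z)]
  have h2 : z.re = ‖z‖ * Real.cos |z.arg| := by
    rw [Real.cos_abs, Complex.norm_mul_cos_arg]
  rw [h1, h2, Real.sin_sub]; ring

theorem mem_sector_iff {ω : ℝ} (h0 : 0 < ω) (h1 : ω < Real.pi) (z : ℂ) :
    z ∈ sector ω ↔ |z.im| * Real.cos ω < z.re * Real.sin ω := by
  rw [← sub_pos, re_mul_sin_sub_abs_im_mul_cos]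
  have hz := Complex.abs_arg_le_pi z
  have hz' := abs_nonneg z.arg
  constructor
  · rintro ⟨hz0, hz1⟩
    exact mul_pos (norm_pos_iff.2 hz0) (Real.sin_pos_of_pos_of_lt_pi (by linarith) (by linarith))
  · intro h
    refine ⟨fun h0 => by simp [h0] at h, ?_⟩
    by_contra hc
    have : Real.sin (ω - |z.arg|) ≤ 0 :=
      Real.sin_nonpos_of_nonpos_of_neg_pi_le (by linarith) (by linarith)
    exact absurd h (not_lt.2 (mul_nonpos_of_nonneg_of_nonpos (norm_nonneg z) this))

theorem lt_abs_arg_iff {ω : ℝ} (h0 : 0 < ω) (h1 : ω < Real.pi) (z : ℂ) :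
    ω < |z.arg| ↔ z.re * Real.sin ω < |z.im| * Real.cos ω := by
  rw [← sub_neg (b := |z.im| * Real.cos ω), re_mul_sin_sub_abs_im_mul_cos]
  have hz := Complex.abs_arg_le_pi z
  have hz' := abs_nonneg z.arg
  constructor
  · intro hz1
    refine mul_neg_of_pos_of_neg (norm_pos_iff.2 fun h => ?_)
      (Real.sin_neg_of_neg_of_neg_pi_lt (by linarith) (by linarith))
    simp [h] at hz1; linarith
  · intro h
    by_contra hc
    have : 0 ≤ Real.sin (ω - |z.arg|) :=
      Real.sin_nonneg_of_nonneg_of_le_pi (by linarith) (by linarith)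
    exact absurd h (not_lt.2 (mul_nonneg (norm_nonneg z) this))

theorem isOpen_sector {ω : ℝ} (h0 : 0 < ω) (h1 : ω < Real.pi) : IsOpen (sector ω) := by
  have : sector ω = {z : ℂ | |z.im| * Real.cos ω < z.re * Real.sin ω} := by
    ext z; exact mem_sector_iff h0 h1 z
  rw [this]
  exact isOpen_lt (by fun_prop) (by fun_prop)

theorem isOpen_lt_abs_arg {ω : ℝ} (h0 : 0 < ω) (h1 : ω < Real.pi) :
    IsOpen {z : ℂ | ω < |z.arg|} := by
  simp only [lt_abs_arg_iff h0 h1]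
  exact isOpen_lt (by fun_prop) (by fun_prop)

theorem closure_sector_subset {ω : ℝ} (h0 : 0 < ω) (h1 : ω < Real.pi) :
    closure (sector ω) ⊆ {z : ℂ | |z.arg| ≤ ω} := by
  have : {z : ℂ | |z.arg| ≤ ω} = {z : ℂ | ω < |z.arg|}ᶜ := by ext; simp
  rw [this]
  refine closure_minimal (fun z hz => ?_) (isOpen_lt_abs_arg h0 h1).isClosed_compl
  simpa using hz.2.le

theorem sector_mono {a b : ℝ} (h : a ≤ b) : sector a ⊆ sector b :=
  fun _ hz => ⟨hz.1, hz.2.trans_le h⟩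

theorem smul_mem_sector {a t : ℝ} (ht : 0 < t) {z : ℂ} (hz : z ∈ sector a) :
    (t : ℂ) * z ∈ sector a := by
  refine ⟨mul_ne_zero (by exact_mod_cast ht.ne') hz.1, ?_⟩
  rw [Complex.arg_real_mul _ ht]; exact hz.2

theorem isPreconnected_sector {ω : ℝ} (h0 : 0 < ω) (h1 : ω < Real.pi / 2) :
    IsPreconnected (sector ω) := by
  apply Convex.isPreconnected
  have hc : 0 < Real.cos ω := Real.cos_pos_of_mem_Ioo ⟨by linarith, h1⟩
  have hpi := Real.pi_pos
  intro x hx y hy a b ha hb hab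
  rw [mem_sector_iff h0 (by linarith)] at *
  simp only [Complex.add_im, Complex.real_smul, Complex.re_ofReal_mul, Complex.im_ofReal_mul,
    Complex.add_re]
  have h2 : |a * x.im + b * y.im| ≤ a * |x.im| + b * |y.im| := by
    refine (abs_add_le _ _).trans ?_
    rw [abs_mul, abs_mul, abs_of_nonneg ha, abs_of_nonneg hb]
  have h3 := mul_le_mul_of_nonneg_right h2 hc.le
  rcases ha.eq_or_lt with rfl | ha
  · have : b = 1 := by linarith
    subst this; simpa using hy
  · nlinarith

theorem isPreconnected_lt_abs_arg {ω : ℝ} (h0 : 0 < ω) (h1 : ω < Real.pi / 2) :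
    IsPreconnected {z : ℂ | ω < |z.arg|} := by
  have hpi := Real.pi_pos
  have hs : 0 < Real.sin ω := Real.sin_pos_of_pos_of_lt_pi h0 (by linarith)
  have : StarConvex ℝ (-1 : ℂ) {z : ℂ | ω < |z.arg|} := by
    intro y hy a b ha hb hab
    simp only [mem_ofPred_eq] at *
    rw [lt_abs_arg_iff h0 (by linarith)] at *
    simp only [Complex.add_im, Complex.real_smul, Complex.re_ofReal_mul, Complex.im_ofReal_mul,
      Complex.add_re, Complex.neg_re, Complex.one_re, Complex.neg_im, Complex.one_im, neg_zero,
      mul_zero, zero_add, abs_mul, abs_of_nonneg hb]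
    rcases hb.eq_or_lt with rfl | hb
    · have : a = 1 := by linarith
      subst this; simpa using hs
    · nlinarith
  have h1' : (-1 : ℂ) ∈ {z : ℂ | ω < |z.arg|} := by
    rw [mem_ofPred_eq, Complex.arg_neg_one, abs_of_pos Real.pi_pos]; linarith
  exact (this.isPathConnected h1').isConnected.isPreconnected

theorem cos_le_cos_of_le_abs {d x : ℝ} (hd : 0 ≤ d) (h1 : d ≤ |x|) (h2 : |x| ≤ 2 * Real.pi - d) :
    Real.cos x ≤ Real.cos d := by
  rw [← Real.cos_abs x]
  rcases le_total |x| Real.pi with h | h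
  · exact Real.cos_le_cos_of_nonneg_of_le_pi hd h h1
  · rw [← Real.cos_two_pi_sub |x|]
    exact Real.cos_le_cos_of_nonneg_of_le_pi hd (by linarith) (by linarith)

/-- Two points whose arguments differ by at least `b - a` are far apart relative to their size. -/
theorem sq_norm_sub_ge {a b : ℝ} {z ζ : ℂ} (hab : a ≤ b) (hba : b - a ≤ Real.pi / 2)
    (hz : |z.arg| ≤ a) (hζ : b ≤ |ζ.arg|) :
    (1 - Real.cos (b - a)) * (‖ζ‖ ^ 2 + ‖z‖ ^ 2) ≤ ‖ζ - z‖ ^ 2 := by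
  have h1 := Complex.abs_arg_le_pi ζ
  have h4 := abs_nonneg z.arg
  have h2 : Real.cos (ζ.arg - z.arg) ≤ Real.cos (b - a) := by
    apply cos_le_cos_of_le_abs (by linarith)
    · have := abs_sub_abs_le_abs_sub ζ.arg z.arg
      linarith
    · have := abs_sub ζ.arg z.arg
      linarith
  have h3 : ‖ζ - z‖ ^ 2 = ‖ζ‖ ^ 2 + ‖z‖ ^ 2 - 2 * (‖ζ‖ * ‖z‖) * Real.cos (ζ.arg - z.arg) := by
    rw [Complex.sq_norm, Complex.normSq_apply, Real.cos_sub, Complex.sq_norm, Complex.sq_norm,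
      Complex.normSq_apply, Complex.normSq_apply]
    simp only [Complex.sub_re, Complex.sub_im]
    have e1 := Complex.norm_mul_cos_arg ζ
    have e2 := Complex.norm_mul_cos_arg z
    have e3 := Complex.norm_mul_sin_arg ζ
    have e4 := Complex.norm_mul_sin_arg z
    rw [← e1, ← e2, ← e3, ← e4]; ring
  rw [h3]
  have h5 : 0 ≤ ‖ζ‖ * ‖z‖ := by positivity
  have h6 : 2 * (‖ζ‖ * ‖z‖) ≤ ‖ζ‖ ^ 2 + ‖z‖ ^ 2 := by nlinarith [sq_nonneg (‖ζ‖ - ‖z‖)]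
  have h7 := mul_le_mul_of_nonneg_left h2 h5
  have h8 : Real.cos (b - a) ≤ 1 := Real.cos_le_one _
  have h9 : -1 ≤ Real.cos (ζ.arg - z.arg) := Real.neg_one_le_cos _
  have h : 0 ≤ Real.cos (b - a) := Real.cos_nonneg_of_mem_Icc ⟨by linarith [Real.pi_pos], hba⟩
  nlinarith

theorem one_sub_cos_pos {x : ℝ} (h : 0 < x) (h' : x ≤ Real.pi / 2) : 0 < 1 - Real.cos x := by
  have := Real.cos_lt_cos_of_nonneg_of_le_pi_div_two le_rfl h' h
  rw [Real.cos_zero] at this; linarith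

theorem arg_exp_mul_I {β : ℝ} (h1 : -Real.pi < β) (h2 : β ≤ Real.pi) :
    (Complex.exp (β * Complex.I)).arg = β := by
  rw [Complex.arg_exp_mul_I, toIocMod_eq_self]
  constructor <;> linarith

/-! ### Primitives by integration along rays -/

section Rays

variable {E : Type*} [NormedAddCommGroup E] [NormedSpace ℂ E]

/-- Differentiation under the integral sign for `z ↦ ∫ t in I, z • F (t z)`, which is the integral
of `F` along the part of the ray through `z` that `I` parametrizes. A locally uniform integrable
bound on `F` suffices, because Cauchy's estimate turns it into a bound on the derivative. -/
theorem hasDerivAt_integral_ray [CompleteSpace E] {U : Set ℂ} (hU : IsOpen U) {I : Set ℝ}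
    (hI : MeasurableSet I) (hIU : ∀ t ∈ I, ∀ z ∈ U, (t : ℂ) * z ∈ U) {F : ℂ → E}
    (hF : DifferentiableOn ℂ F U) {z₀ : ℂ} {δ : ℝ} (hδ : 0 < δ) {bd : ℝ → ℝ}
    (hbd : IntegrableOn bd I)
    (hb : ∀ z ∈ Metric.ball z₀ δ, z ∈ U ∧ ∀ t ∈ I, ‖F (t * z)‖ ≤ bd t) :
    IntegrableOn (fun t : ℝ => F (t * z₀) + ((t : ℂ) * z₀) • deriv F (t * z₀)) I ∧
      HasDerivAt (fun z : ℂ => ∫ t in I, z • F (t * z))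
        (∫ t in I, (F (t * z₀) + ((t : ℂ) * z₀) • deriv F (t * z₀))) z₀ := by
  have hcont : ∀ z ∈ U, ContinuousOn (fun t : ℝ => F (t * z)) I := fun z hz =>
    hF.continuousOn.comp (by fun_prop) fun t ht => hIU t ht z hz
  have hder : ∀ t ∈ I, ∀ z ∈ U, HasDerivAt (fun z : ℂ => z • F (t * z))
      (F (t * z) + ((t : ℂ) * z) • deriv F (t * z)) z := by
    intro t ht z hz
    have h1 : HasDerivAt F (deriv F (t * z)) (t * z) :=
      (hF.differentiableAt (hU.mem_nhds (hIU t ht z hz))).hasDerivAt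
    have h2 : HasDerivAt (fun z : ℂ => (t : ℂ) * z) t z := by
      simpa using (hasDerivAt_id z).const_mul (t : ℂ)
    have h3 := (hasDerivAt_id z).smul (h1.scomp z h2)
    have h4 : F (t * z) + ((t : ℂ) * z) • deriv F (t * z) =
        id z • (t : ℂ) • deriv F (t * z) + (1 : ℂ) • (F ∘ HMul.hMul (t : ℂ)) z := by
      rw [id, one_smul, add_comm, smul_smul, mul_comm z]; rfl
    rw [h4]; exact h3
  have hz₀ : z₀ ∈ U := (hb z₀ (Metric.mem_ball_self hδ)).1
  have hderiv_cont :
      ContinuousOn (fun t : ℝ => F (t * z₀) + ((t : ℂ) * z₀) • deriv F (t * z₀)) I := by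
    refine (hcont z₀ hz₀).add (ContinuousOn.smul (by fun_prop) ?_)
    exact (hF.deriv hU).continuousOn.comp (by fun_prop) fun t ht => hIU t ht z₀ hz₀
  have key := hasDerivAt_integral_of_dominated_loc_of_deriv_le (μ := volume.restrict I)
    (F := fun (z : ℂ) (t : ℝ) => z • F (t * z))
    (F' := fun (z : ℂ) (t : ℝ) => F (t * z) + ((t : ℂ) * z) • deriv F (t * z))
    (x₀ := z₀) (s := Metric.ball z₀ (δ / 2)) (bound := fun t => (‖z₀‖ + δ) * bd t / (δ / 2))
    (Metric.ball_mem_nhds _ (by linarith)) ?_ ?_ ?_ ?_ ?_ ?_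
  · exact key
  · filter_upwards [Metric.ball_mem_nhds z₀ hδ] with z hz
    exact ((hcont z (hb z hz).1).const_smul z).aestronglyMeasurable hI
  · refine ((hbd.const_mul ‖z₀‖)).mono' (((hcont z₀ hz₀).const_smul z₀).aestronglyMeasurable hI) ?_
    filter_upwards [ae_restrict_mem hI] with t ht
    rw [norm_smul]
    exact mul_le_mul_of_nonneg_left ((hb z₀ (Metric.mem_ball_self hδ)).2 t ht) (norm_nonneg _)
  · exact hderiv_cont.aestronglyMeasurable hI
  · filter_upwards [ae_restrict_mem hI] with t ht z hz
    have hsub : Metric.closedBall z (δ / 2) ⊆ Metric.ball z₀ δ := by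
      apply Metric.closedBall_subset_ball'
      rw [Metric.mem_ball] at hz; linarith
    have hzU : z ∈ U := (hb z (hsub (Metric.mem_closedBall_self (by linarith)))).1
    rw [← (hder t ht z hzU).deriv]
    refine Complex.norm_deriv_le_of_forall_mem_sphere_norm_le (by linarith) ?_ ?_
    · refine DifferentiableOn.diffContOnCl fun x hx => ?_
      rw [closure_ball _ (by linarith)] at hx
      exact (hder t ht x (hb x (hsub hx)).1).differentiableAt.differentiableWithinAt
    · intro x hx
      have hx' := hsub (Metric.sphere_subset_closedBall hx)
      rw [norm_smul]
      refine mul_le_mul ?_ ((hb x hx').2 t ht) (norm_nonneg _) (by positivity)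
      have : ‖x‖ ≤ ‖z₀‖ + ‖x - z₀‖ := norm_le_norm_add_norm_sub' x z₀
      rw [Metric.mem_ball, dist_eq_norm] at hx'
      linarith
  · exact (hbd.const_mul _).div_const _
  · filter_upwards [ae_restrict_mem hI] with t ht z hz
    refine hder t ht z (hb z (Metric.ball_subset_ball (by linarith) hz)).1

/-- The weight `x^(s-1) / (1 + x^(2s))`, integrable on `(0, ∞)`: the decay of `f(z) R(z, A)` along
rays when `f` belongs to `H^∞_0` of a sector. -/
noncomputable def decay (s x : ℝ) : ℝ := x ^ (s - 1) / (1 + x ^ (2 * s))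

theorem decay_nonneg (s : ℝ) {x : ℝ} (hx : 0 ≤ x) : 0 ≤ decay s x := by
  unfold decay; positivity

theorem decay_le_rpow (s : ℝ) {x : ℝ} (hx : 0 ≤ x) : decay s x ≤ x ^ (s - 1) := by
  unfold decay
  exact div_le_self (by positivity) (by linarith [Real.rpow_nonneg hx (2 * s)])

theorem decay_le_rpow_neg (s : ℝ) {x : ℝ} (hx : 0 < x) : decay s x ≤ x ^ (-s - 1) := by
  unfold decay
  rw [div_le_iff₀ (by positivity), mul_add, ← Real.rpow_add hx]
  have h2 : -s - 1 + 2 * s = s - 1 := by ring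
  rw [h2]
  have : 0 ≤ x ^ (-s - 1) := by positivity
  linarith

theorem continuousOn_decay (s : ℝ) : ContinuousOn (decay s) (Ioi 0) := by
  intro x hx
  have hx' : 0 < x := hx
  apply ContinuousAt.continuousWithinAt
  unfold decay
  refine ContinuousAt.div (Real.continuousAt_rpow_const _ _ (Or.inl hx'.ne'))
    (continuousAt_const.add (Real.continuousAt_rpow_const _ _ (Or.inl hx'.ne'))) (by positivity)

theorem integrableOn_rpow_Ioc {s : ℝ} (hs : 0 < s) (b : ℝ) :
    IntegrableOn (fun x : ℝ => x ^ (s - 1)) (Ioc 0 b) := by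
  rcases le_total 0 b with hb | hb
  · rw [← intervalIntegrable_iff_integrableOn_Ioc_of_le hb]
    exact intervalIntegral.intervalIntegrable_rpow' (by linarith)
  · simp [Ioc_eq_empty (not_lt.2 hb)]

theorem integrableOn_decay {s : ℝ} (hs : 0 < s) : IntegrableOn (decay s) (Ioi 0) := by
  rw [← Ioc_union_Ioi_eq_Ioi zero_le_one]
  refine IntegrableOn.union ?_ ?_
  · refine (integrableOn_rpow_Ioc hs 1).mono'
      (((continuousOn_decay s).mono Ioc_subset_Ioi_self).aestronglyMeasurable measurableSet_Ioc) ?_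
    filter_upwards [ae_restrict_mem measurableSet_Ioc] with x hx
    rw [Real.norm_of_nonneg (decay_nonneg s hx.1.le)]
    exact decay_le_rpow s hx.1.le
  · refine (integrableOn_Ioi_rpow_of_lt (a := -s - 1) (c := 1) (by linarith) one_pos).mono'
      (((continuousOn_decay s).mono (Ioi_subset_Ioi zero_le_one)).aestronglyMeasurable
        measurableSet_Ioi) ?_
    filter_upwards [ae_restrict_mem measurableSet_Ioi] with x hx
    have hx : 0 < x := zero_lt_one.trans hx
    rw [Real.norm_of_nonneg (decay_nonneg s hx.le)]
    exact decay_le_rpow_neg s hx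

theorem decay_mul_le {s a b t y : ℝ} (hs : 0 < s) (ha : 0 < a) (hay : a ≤ y) (hyb : y ≤ b)
    (ht : 0 < t) :
    decay s (t * y) ≤ b ^ s / a * (1 + (a ^ (2 * s))⁻¹) * decay s t := by
  have hy : 0 < y := ha.trans_le hay
  have hb : 0 < b := hy.trans_le hyb
  unfold decay
  rw [Real.mul_rpow ht.le hy.le, Real.mul_rpow ht.le hy.le]
  have h1 : y ^ (s - 1) ≤ b ^ s / a := by
    rw [Real.rpow_sub hy, Real.rpow_one]
    exact div_le_div₀ (by positivity) (Real.rpow_le_rpow hy.le hyb hs.le) ha hay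
  have h2 : a ^ (2 * s) ≤ y ^ (2 * s) := Real.rpow_le_rpow ha.le hay (by linarith)
  have h3 : 0 < a ^ (2 * s) := by positivity
  have h4 : 0 < t ^ (2 * s) := by positivity
  have h5 : (1 + t ^ (2 * s) * y ^ (2 * s))⁻¹ ≤ (1 + (a ^ (2 * s))⁻¹) * (1 + t ^ (2 * s))⁻¹ := by
    rw [← div_eq_mul_inv, le_div_iff₀ (by positivity), inv_mul_le_iff₀ (by positivity)]
    have : t ^ (2 * s) * a ^ (2 * s) ≤ t ^ (2 * s) * y ^ (2 * s) := by gcongr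
    have h6 : t ^ (2 * s) * a ^ (2 * s) * (a ^ (2 * s))⁻¹ = t ^ (2 * s) := by field_simp
    have h7 : 0 < (a ^ (2 * s))⁻¹ := by positivity
    nlinarith
  calc t ^ (s - 1) * y ^ (s - 1) / (1 + t ^ (2 * s) * y ^ (2 * s))
      = t ^ (s - 1) * (y ^ (s - 1) * (1 + t ^ (2 * s) * y ^ (2 * s))⁻¹) := by ring
    _ ≤ t ^ (s - 1) * (b ^ s / a * ((1 + (a ^ (2 * s))⁻¹) * (1 + t ^ (2 * s))⁻¹)) := by gcongr
    _ = _ := by ring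

theorem tendsto_mul_decay_zero {s : ℝ} (hs : 0 < s) :
    Tendsto (fun t => t * decay s t) (𝓝[>] 0) (𝓝 0) := by
  have h : Tendsto (fun t : ℝ => t ^ s) (𝓝[>] 0) (𝓝 0) := by
    have := (Real.continuousAt_rpow_const 0 s (Or.inr hs.le)).tendsto
    rw [Real.zero_rpow hs.ne'] at this
    exact this.mono_left nhdsWithin_le_nhds
  refine squeeze_zero' ?_ ?_ h
  · filter_upwards [self_mem_nhdsWithin] with t ht
    exact mul_nonneg (le_of_lt ht) (decay_nonneg s (le_of_lt ht))
  · filter_upwards [self_mem_nhdsWithin] with t ht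
    have ht : 0 < t := ht
    calc t * decay s t ≤ t * t ^ (s - 1) := by gcongr; exact decay_le_rpow s ht.le
      _ = t ^ s := by rw [Real.rpow_sub_one ht.ne']; field_simp

theorem tendsto_mul_decay_atTop {s : ℝ} (hs : 0 < s) :
    Tendsto (fun t => t * decay s t) atTop (𝓝 0) := by
  refine squeeze_zero' ?_ ?_ (tendsto_rpow_neg_atTop hs)
  · filter_upwards [eventually_gt_atTop 0] with t ht
    exact mul_nonneg ht.le (decay_nonneg s ht.le)
  · filter_upwards [eventually_gt_atTop 0] with t ht
    calc t * decay s t ≤ t * t ^ (-s - 1) := by gcongr; exact decay_le_rpow_neg s ht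
      _ = t ^ (-s) := by rw [Real.rpow_sub_one ht.ne']; field_simp


section Primitive

variable {U : Set ℂ} {F : ℂ → E} {s c : ℝ}

theorem hasDerivAt_integral_ray_of_decay [CompleteSpace E] (hU : IsOpen U) (h0 : (0 : ℂ) ∉ U)
    {I : Set ℝ} (hI : MeasurableSet I) (hI0 : I ⊆ Ioi 0) (hIU : ∀ t ∈ I, ∀ z ∈ U, (t : ℂ) * z ∈ U)
    (hF : DifferentiableOn ℂ F U) (hs : 0 < s)
    (hb : ∀ z ∈ U, ‖F z‖ ≤ c * decay s ‖z‖) {z₀ : ℂ} (hz₀ : z₀ ∈ U) :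
    IntegrableOn (fun t : ℝ => F (t * z₀) + ((t : ℂ) * z₀) • deriv F (t * z₀)) I ∧
      HasDerivAt (fun z : ℂ => ∫ t in I, z • F (t * z))
        (∫ t in I, (F (t * z₀) + ((t : ℂ) * z₀) • deriv F (t * z₀))) z₀ := by
  have hz₀' : 0 < ‖z₀‖ := norm_pos_iff.2 fun h => h0 (h ▸ hz₀)
  obtain ⟨ε, hε, hεU⟩ := Metric.isOpen_iff.1 hU z₀ hz₀
  have hc : 0 ≤ c := by
    have h1 := (norm_nonneg _).trans (hb z₀ hz₀)
    have h2 : 0 < decay s ‖z₀‖ := by unfold decay; positivity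
    exact nonneg_of_mul_nonneg_left h1 h2
  refine hasDerivAt_integral_ray hU hI hIU hF (δ := min ε (‖z₀‖ / 2)) (by positivity)
    (bd := fun t => c * ((2 * ‖z₀‖) ^ s / (‖z₀‖ / 2) * (1 + ((‖z₀‖ / 2) ^ (2 * s))⁻¹) * decay s t))
    ((((integrableOn_decay hs).mono_set hI0).const_mul _).const_mul c) fun z hz => ?_
  have hzU : z ∈ U := hεU (Metric.ball_subset_ball (min_le_left _ _) hz)
  refine ⟨hzU, fun t ht => (hb _ (hIU t ht z hzU)).trans (mul_le_mul_of_nonneg_left ?_ hc)⟩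
  have ht0 : 0 < t := hI0 ht
  rw [norm_mul, Complex.norm_real, Real.norm_of_nonneg ht0.le]
  rw [Metric.mem_ball, lt_min_iff, dist_eq_norm] at hz
  have h1 : ‖z‖ ≤ ‖z₀‖ + ‖z - z₀‖ := norm_le_norm_add_norm_sub' z z₀
  have h2 : ‖z₀‖ - ‖z - z₀‖ ≤ ‖z‖ := by
    have := norm_sub_norm_le z₀ z
    rw [norm_sub_rev] at this; linarith
  exact decay_mul_le hs (by linarith) (by linarith [hz.2]) (by linarith [hz.2]) ht0

/-- The derivative in `z` of the integrand `z • F (t z)` equals the derivative in `t` of `t • F (t z)`,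
so that the integral of the former is computed by boundary values of the latter. -/
theorem hasDerivAt_mul_smul_ray (hU : IsOpen U) (hF : DifferentiableOn ℂ F U) {t : ℝ} {z : ℂ}
    (htz : (t : ℂ) * z ∈ U) :
    HasDerivAt (fun t : ℝ => (t : ℂ) • F (t * z))
      (F (t * z) + ((t : ℂ) * z) • deriv F (t * z)) t := by
  have h1 : HasDerivAt F (deriv F (t * z)) (t * z) :=
    (hF.differentiableAt (hU.mem_nhds htz)).hasDerivAt
  have h2 : HasDerivAt (fun x : ℂ => x * z) z t := by
    simpa using (hasDerivAt_id (t : ℂ)).mul_const z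
  have h5 : HasDerivAt (fun x : ℝ => (x : ℂ)) 1 t := Complex.ofRealCLM.hasDerivAt
  have h3 := ((hasDerivAt_id (t : ℂ)).smul (h1.scomp (t : ℂ) h2)).scomp t h5
  have h4 : F (t * z) + ((t : ℂ) * z) • deriv F (t * z) =
      (1 : ℂ) • (id (t : ℂ) • z • deriv F (t * z) + (1 : ℂ) • (F ∘ fun x : ℂ => x * z) t) := by
    rw [id, one_smul, one_smul, add_comm, smul_smul]; rfl
  rw [h4]; exact h3

theorem tendsto_smul_ray {l : Filter ℝ} (hs : 0 < s) {z : ℂ} (hz : z ≠ 0)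
    (hl : ∀ᶠ t : ℝ in l, 0 < t ∧ ‖F (t * z)‖ ≤ c * decay s ‖(t : ℂ) * z‖)
    (hlim : Tendsto (fun t => t * decay s t) l (𝓝 0)) :
    Tendsto (fun t : ℝ => (t : ℂ) • F (t * z)) l (𝓝 0) := by
  have hz' : 0 < ‖z‖ := norm_pos_iff.2 hz
  have h := hlim.const_mul (|c| * (‖z‖ ^ s / ‖z‖ * (1 + (‖z‖ ^ (2 * s))⁻¹)))
  rw [mul_zero] at h
  refine squeeze_zero_norm' ?_ h
  filter_upwards [hl] with t ht
  rw [norm_smul, Complex.norm_real, Real.norm_of_nonneg ht.1.le]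
  have h1 := ht.2
  rw [norm_mul, Complex.norm_real, Real.norm_of_nonneg ht.1.le] at h1
  have h2 := decay_mul_le hs hz' le_rfl le_rfl ht.1
  have h3 := decay_nonneg s (mul_pos ht.1 hz').le
  have h4 := abs_nonneg c
  calc t * ‖F (t * z)‖ ≤ t * (|c| * decay s (t * ‖z‖)) := by
        refine mul_le_mul_of_nonneg_left (h1.trans ?_) ht.1.le
        gcongr; exact le_abs_self c
    _ ≤ t * (|c| * (‖z‖ ^ s / ‖z‖ * (1 + (‖z‖ ^ (2 * s))⁻¹) * decay s t)) := by
        have := ht.1.le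
        gcongr
    _ = _ := by ring

/-- A primitive on a domain that is star-shaped about `0`, given by integration from `0`. -/
theorem hasDerivAt_integral_ray_Ioc [CompleteSpace E] (hU : IsOpen U) (h0 : (0 : ℂ) ∉ U)
    (hIU : ∀ t ∈ Ioc (0 : ℝ) 1, ∀ z ∈ U, (t : ℂ) * z ∈ U)
    (hF : DifferentiableOn ℂ F U) (hs : 0 < s)
    (hb : ∀ z ∈ U, ‖F z‖ ≤ c * decay s ‖z‖) {z₀ : ℂ} (hz₀ : z₀ ∈ U) :
    HasDerivAt (fun z : ℂ => ∫ t in Ioc (0 : ℝ) 1, z • F (t * z)) (F z₀) z₀ := by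
  obtain ⟨h1, h2⟩ := hasDerivAt_integral_ray_of_decay hU h0 measurableSet_Ioc
    Ioc_subset_Ioi_self hIU hF hs hb hz₀
  have hz : z₀ ≠ 0 := fun h => h0 (h ▸ hz₀)
  have hd := fun (t : ℝ) (ht : t ∈ Ioc (0 : ℝ) 1) => hasDerivAt_mul_smul_ray hU hF (hIU t ht z₀ hz₀)
  rw [← intervalIntegral.integral_of_le zero_le_one,
    intervalIntegral.integral_eq_sub_of_hasDerivAt_of_tendsto (fa := 0)
      (fb := (((1 : ℝ) : ℂ)) • F ((1 : ℝ) * z₀)) zero_lt_one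
      (fun t ht => hd t (Ioo_subset_Ioc_self ht))
      ((intervalIntegrable_iff_integrableOn_Ioc_of_le zero_le_one).2 h1) ?_ ?_] at h2
  · simpa using h2
  · refine tendsto_smul_ray (c := c) hs hz ?_ (tendsto_mul_decay_zero hs)
    filter_upwards [Ioc_mem_nhdsGT (zero_lt_one' ℝ)] with t ht
    exact ⟨ht.1, hb _ (hIU t ht z₀ hz₀)⟩
  · exact (hd 1 (by simp)).continuousAt.tendsto.mono_left nhdsWithin_le_nhds

/-- A primitive (up to sign) on a domain that is star-shaped about infinity, given by integration
to infinity. -/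
theorem hasDerivAt_integral_ray_Ioi_one [CompleteSpace E] (hU : IsOpen U) (h0 : (0 : ℂ) ∉ U)
    (hIU : ∀ t ∈ Ici (1 : ℝ), ∀ z ∈ U, (t : ℂ) * z ∈ U)
    (hF : DifferentiableOn ℂ F U) (hs : 0 < s)
    (hb : ∀ z ∈ U, ‖F z‖ ≤ c * decay s ‖z‖) {z₀ : ℂ} (hz₀ : z₀ ∈ U) :
    HasDerivAt (fun z : ℂ => ∫ t in Ioi (1 : ℝ), z • F (t * z)) (-F z₀) z₀ := by
  have hsub : Ioi (1 : ℝ) ⊆ Ici 1 := Ioi_subset_Ici_self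
  obtain ⟨h1, h2⟩ := hasDerivAt_integral_ray_of_decay hU h0 measurableSet_Ioi
    (Ioi_subset_Ioi zero_le_one) (fun t ht => hIU t (hsub ht)) hF hs hb hz₀
  have hz : z₀ ≠ 0 := fun h => h0 (h ▸ hz₀)
  have hd := fun (t : ℝ) (ht : t ∈ Ici (1 : ℝ)) => hasDerivAt_mul_smul_ray hU hF (hIU t ht z₀ hz₀)
  rw [integral_Ioi_of_hasDerivAt_of_tendsto' hd h1 (m := 0) ?_] at h2
  · simpa using h2
  · refine tendsto_smul_ray (c := c) hs hz ?_ (tendsto_mul_decay_atTop hs)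
    filter_upwards [eventually_ge_atTop 1] with t ht
    exact ⟨by linarith, hb _ (hIU t ht z₀ hz₀)⟩

/-- On a connected open cone, the integral of a decaying holomorphic function along a ray from `0`
to infinity does not depend on the ray. -/
theorem integral_ray_eq [CompleteSpace E] (hU : IsOpen U) (h0 : (0 : ℂ) ∉ U)
    (hconn : IsPreconnected U) (hIU : ∀ t ∈ Ioi (0 : ℝ), ∀ z ∈ U, (t : ℂ) * z ∈ U)
    (hF : DifferentiableOn ℂ F U) (hs : 0 < s)
    (hb : ∀ z ∈ U, ‖F z‖ ≤ c * decay s ‖z‖) {z w : ℂ} (hz : z ∈ U) (hw : w ∈ U) :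
    ∫ t in Ioi (0 : ℝ), z • F (t * z) = ∫ t in Ioi (0 : ℝ), w • F (t * w) := by
  have key : ∀ x ∈ U, HasDerivAt (fun z : ℂ => ∫ t in Ioi (0 : ℝ), z • F (t * z)) 0 x := by
    intro x hx
    obtain ⟨h1, h2⟩ := hasDerivAt_integral_ray_of_decay hU h0 measurableSet_Ioi subset_rfl hIU
      hF hs hb hx
    have hx0 : x ≠ 0 := fun h => h0 (h ▸ hx)
    rw [integral_Ioi_of_hasDerivAt_of_tendsto (f := fun t : ℝ => (t : ℂ) • F (t * x)) ?_
      (fun t ht => hasDerivAt_mul_smul_ray hU hF (hIU t ht x hx)) h1 (m := 0) ?_] at h2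
    · simpa using h2
    · rw [← continuousWithinAt_Ioi_iff_Ici, ContinuousWithinAt, Complex.ofReal_zero, zero_smul]
      refine tendsto_smul_ray (c := c) hs hx0 ?_ (tendsto_mul_decay_zero hs)
      filter_upwards [self_mem_nhdsWithin] with t ht
      exact ⟨ht, hb _ (hIU t ht x hx)⟩
    · refine tendsto_smul_ray (c := c) hs hx0 ?_ (tendsto_mul_decay_atTop hs)
      filter_upwards [eventually_gt_atTop 0] with t ht
      exact ⟨ht, hb _ (hIU t ht x hx)⟩
  exact hU.is_const_of_deriv_eq_zero hconn
    (fun x hx => (key x hx).differentiableAt.differentiableWithinAt)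
    (fun x hx => (key x hx).deriv) hz hw

end Primitive

end Rays

/-! ### Resolvents and scalar kernels -/

section Resolvent

variable {X : Type*} [NormedAddCommGroup X] [NormedSpace ℂ X]

theorem resolvent_mul_cancel {A : X →L[ℂ] X} {z : ℂ} (hz : z ∈ resolventSet ℂ A) :
    resolvent A z * (z • 1 - A) = 1 := by
  rw [resolvent, Algebra.algebraMap_eq_smul_one]
  refine Ring.inverse_mul_cancel _ ?_
  rwa [spectrum.mem_resolventSet_iff, Algebra.algebraMap_eq_smul_one] at hz

theorem mul_resolvent_cancel {A : X →L[ℂ] X} {z : ℂ} (hz : z ∈ resolventSet ℂ A) :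
    (z • 1 - A) * resolvent A z = 1 := by
  rw [resolvent, Algebra.algebraMap_eq_smul_one]
  refine Ring.mul_inverse_cancel _ ?_
  rwa [spectrum.mem_resolventSet_iff, Algebra.algebraMap_eq_smul_one] at hz

theorem resolvent_sub_resolvent_eq {A : X →L[ℂ] X} {z w : ℂ} (hz : z ∈ resolventSet ℂ A)
    (hw : w ∈ resolventSet ℂ A) :
    resolvent A z - resolvent A w = (w - z) • (resolvent A z * resolvent A w) := by
  have h1 : resolvent A z * ((w • 1 - A) - (z • 1 - A)) * resolvent A w =
      resolvent A z - resolvent A w := by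
    rw [mul_sub, sub_mul, mul_assoc, mul_resolvent_cancel hw, resolvent_mul_cancel hz, mul_one,
      one_mul]
  rw [← h1, sub_sub_sub_cancel_right, ← sub_smul, mul_smul_comm, mul_one, smul_mul_assoc]

theorem resolvent_mul_self {A : X →L[ℂ] X} {z : ℂ} (hz : z ∈ resolventSet ℂ A) :
    resolvent A z * A = z • resolvent A z - 1 := by
  have := resolvent_mul_cancel hz
  rw [mul_sub, mul_smul_comm, mul_one] at this
  rw [← this]; abel

theorem self_mul_resolvent {A : X →L[ℂ] X} {z : ℂ} (hz : z ∈ resolventSet ℂ A) :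
    A * resolvent A z = z • resolvent A z - 1 := by
  have := mul_resolvent_cancel hz
  rw [sub_mul, smul_mul_assoc, one_mul] at this
  rw [← this]; abel

theorem resolvent_add_resolvent_neg {A : X →L[ℂ] X} {ζ : ℂ} (hz : ζ ∈ resolventSet ℂ A)
    (hw : -ζ ∈ resolventSet ℂ A) :
    resolvent A ζ + resolvent A (-ζ) = (-2 : ℂ) • (A * (resolvent A ζ * resolvent A (-ζ))) := by
  have h1 := resolvent_sub_resolvent_eq hz hw
  rw [← mul_assoc, self_mul_resolvent hz, sub_mul, one_mul, smul_mul_assoc]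
  have h2 : ζ • (resolvent A ζ * resolvent A (-ζ)) =
      (-2⁻¹ : ℂ) • (resolvent A ζ - resolvent A (-ζ)) := by
    rw [h1, smul_smul]; congr 1; ring
  rw [h2]
  module

theorem ring_inverse_neg {R : Type*} [Ring R] (a : R) : Ring.inverse (-a) = -Ring.inverse a := by
  by_cases h : IsUnit a
  · obtain ⟨u, rfl⟩ := h
    rw [← Units.val_neg, Ring.inverse_unit, Ring.inverse_unit, inv_neg, Units.val_neg]
  · rw [Ring.inverse_non_unit _ h, Ring.inverse_non_unit _ (by rwa [IsUnit.neg_iff]), neg_zero]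

theorem resolvent_one_sub (T : X →L[ℂ] X) (z : ℂ) :
    resolvent T (1 - z) = -resolvent (ContinuousLinearMap.id ℂ X - T) z := by
  rw [resolvent, resolvent, ← ring_inverse_neg]
  congr 1
  rw [map_sub, map_one, ContinuousLinearMap.one_def]; abel

theorem mem_resolventSet_one_sub {T : X →L[ℂ] X} {z : ℂ} :
    1 - z ∈ resolventSet ℂ T ↔ z ∈ resolventSet ℂ (ContinuousLinearMap.id ℂ X - T) := by
  rw [spectrum.mem_resolventSet_iff, spectrum.mem_resolventSet_iff, ← IsUnit.neg_iff]
  congr! 1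
  rw [map_sub, map_one, ContinuousLinearMap.one_def]; abel

theorem differentiableAt_resolvent [CompleteSpace X] {A : X →L[ℂ] X} {z : ℂ}
    (hz : z ∈ resolventSet ℂ A) : DifferentiableAt ℂ (resolvent A) z :=
  (spectrum.hasDerivAt_resolvent_const_left hz).differentiableAt

/-- Outside larger sectors, the closures in the definition of sectoriality can be replaced by a
condition on the argument. -/
theorem IsSectorialOfType.exists_bound {A : X →L[ℂ] X} {ω ν : ℝ} (h : IsSectorialOfType A ω)
    (h0 : 0 < ω) (h1 : ω < ν) (h2 : ν < Real.pi) :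
    ∃ C : ℝ, 0 ≤ C ∧ ∀ z : ℂ, ν < |z.arg| → z ∈ resolventSet ℂ A ∧ ‖resolvent A z‖ ≤ C / ‖z‖ := by
  obtain ⟨C, hC⟩ := h.2 ν ⟨h1, h2⟩
  have hν : 0 < ν := h0.trans h1
  have hout : ∀ z : ℂ, ν < |z.arg| → z ∉ closure (sector ν) := fun z hz hz' =>
    absurd (closure_sector_subset hν h2 hz') (not_le.2 hz)
  refine ⟨max C 0, le_max_right _ _, fun z hz => ⟨?_, ?_⟩⟩
  · by_contra hc
    exact hout z hz (closure_mono (sector_mono h1.le) (h.1 hc))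
  · have hz0 : z ≠ 0 := by
      rintro rfl
      simp at hz; linarith
    have := (hC z (hout z hz)).trans (le_max_left C 0)
    rw [norm_smul] at this
    rwa [le_div_iff₀ (norm_pos_iff.2 hz0), mul_comm]

end Resolvent

section Kernel

variable {E : Type*} [NormedAddCommGroup E] [NormedSpace ℂ E]

theorem integrableOn_ray {F : ℂ → E} {w : ℂ} {s c : ℝ} (hs : 0 < s) (hw : w ≠ 0)
    (hF : ∀ t : ℝ, 0 < t → ContinuousAt F (t * w))
    (hb : ∀ t : ℝ, 0 < t → ‖F (t * w)‖ ≤ c * decay s ‖(t : ℂ) * w‖) :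
    IntegrableOn (fun t : ℝ => w • F (t * w)) (Ioi 0) := by
  have hw' : 0 < ‖w‖ := norm_pos_iff.2 hw
  have hcont : ContinuousOn (fun t : ℝ => w • F (t * w)) (Ioi 0) := fun t ht =>
    (ContinuousAt.const_smul (ContinuousAt.comp (f := fun t : ℝ => (t : ℂ) * w) (hF t ht)
      (by fun_prop)) w).continuousWithinAt
  refine (((integrableOn_decay hs).const_mul
    (‖w‖ ^ s / ‖w‖ * (1 + (‖w‖ ^ (2 * s))⁻¹))).const_mul (‖w‖ * |c|)).mono'
    (hcont.aestronglyMeasurable measurableSet_Ioi) ?_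
  filter_upwards [ae_restrict_mem measurableSet_Ioi] with t ht
  have ht : 0 < t := ht
  have h1 := hb t ht
  rw [norm_mul, Complex.norm_real, Real.norm_of_nonneg ht.le] at h1
  have h3 := decay_nonneg s (mul_pos ht hw').le
  rw [norm_smul, mul_assoc]
  refine mul_le_mul_of_nonneg_left (h1.trans ?_) (norm_nonneg _)
  refine (mul_le_mul_of_nonneg_right (le_abs_self c) h3).trans ?_
  exact mul_le_mul_of_nonneg_left (decay_mul_le hs hw' le_rfl le_rfl ht) (abs_nonneg c)

theorem decay_one (x : ℝ) : decay 1 x = 1 / (1 + x ^ 2) := by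
  unfold decay; norm_num

theorem mul_le_of_sq_le {a b x y r : ℝ} (ha : a ^ 2 ≤ x / (1 + r ^ 2))
    (hb : b ^ 2 ≤ y / (1 + r ^ 2)) : a * b ≤ ((x + y) / 2) * decay 1 r := by
  have : ((x + y) / 2) * decay 1 r = (x / (1 + r ^ 2) + y / (1 + r ^ 2)) / 2 := by
    rw [decay_one]; ring
  rw [this]
  nlinarith [sq_nonneg (a - b)]

theorem sq_norm_inv_le {c r : ℝ} {u : ℂ} (hc : 0 < c) (h : c * (1 + r ^ 2) ≤ ‖u‖ ^ 2) :
    ‖u⁻¹‖ ^ 2 ≤ c⁻¹ / (1 + r ^ 2) := by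
  rw [norm_inv, inv_pow, div_eq_mul_inv, ← mul_inv]
  exact inv_anti₀ (by positivity) h

theorem exists_sq_norm_inv_sub_le {a b : ℝ} (hab : a < b) (hba : b - a ≤ Real.pi / 2) {ζ : ℂ}
    (hζ : ζ ≠ 0) (hζ' : b ≤ |ζ.arg|) :
    ∃ c : ℝ, ∀ z : ℂ, |z.arg| ≤ a → ζ - z ≠ 0 ∧ ‖(ζ - z)⁻¹‖ ^ 2 ≤ c / (1 + ‖z‖ ^ 2) := by
  have h1 := one_sub_cos_pos (sub_pos.2 hab) hba
  have hζ0 : 0 < ‖ζ‖ := norm_pos_iff.2 hζ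
  have h2 : 0 < min 1 (‖ζ‖ ^ 2) := by positivity
  refine ⟨((1 - Real.cos (b - a)) * min 1 (‖ζ‖ ^ 2))⁻¹, fun z hz => ?_⟩
  have h3 := sq_norm_sub_ge hab.le hba hz hζ'
  have h4 : (1 - Real.cos (b - a)) * min 1 (‖ζ‖ ^ 2) * (1 + ‖z‖ ^ 2) ≤ ‖ζ - z‖ ^ 2 := by
    refine le_trans ?_ h3
    rw [mul_assoc]
    refine mul_le_mul_of_nonneg_left ?_ h1.le
    have h5 := min_le_left 1 (‖ζ‖ ^ 2)
    have h6 := min_le_right 1 (‖ζ‖ ^ 2)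
    nlinarith [sq_nonneg ‖z‖]
  refine ⟨fun h => ?_, sq_norm_inv_le (by positivity) h4⟩
  rw [h, norm_zero] at h4
  have : 0 < (1 - Real.cos (b - a)) * min 1 (‖ζ‖ ^ 2) * (1 + ‖z‖ ^ 2) := by positivity
  linarith

theorem exists_sq_norm_inv_sub_one_le {b : ℝ} (hb : 0 < b) (hb' : b ≤ Real.pi / 2) :
    ∃ c : ℝ, 0 ≤ c ∧ ∀ z : ℂ, b ≤ |z.arg| →
      z - 1 ≠ 0 ∧ ‖(z - 1)⁻¹‖ ^ 2 ≤ c / (1 + ‖z‖ ^ 2) := by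
  have h1 := one_sub_cos_pos hb hb'
  refine ⟨(1 - Real.cos b)⁻¹, by positivity, fun z hz => ?_⟩
  have h3 := sq_norm_sub_ge (a := 0) (z := 1) hb.le (by simpa using hb') (by simp) hz
  rw [sub_zero, norm_one, one_pow, add_comm (‖z‖ ^ 2)] at h3
  refine ⟨fun h => ?_, sq_norm_inv_le h1 h3⟩
  rw [h, norm_zero] at h3
  have : 0 < (1 - Real.cos b) * (1 + ‖z‖ ^ 2) := by positivity
  linarith

/-- The integral of the reference kernel along a ray in the upper half plane, evaluated by means of
the primitive `log ((1 - z) / (1 + z))`. -/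
theorem integral_ray_reference {w : ℂ} (hw : 0 < w.im)
    (hint : IntegrableOn (fun t : ℝ => w • ((-1 - (t * w : ℂ))⁻¹ + ((t * w : ℂ) - 1)⁻¹)) (Ioi 0)) :
    ∫ t in Ioi (0 : ℝ), w • ((-1 - (t * w : ℂ))⁻¹ + ((t * w : ℂ) - 1)⁻¹) =
      -(Real.pi * Complex.I) := by
  have hw0 : w ≠ 0 := by rintro rfl; simp at hw
  have hne1 : ∀ t : ℝ, 1 + (t : ℂ) * w ≠ 0 := by
    intro t h
    have h1 := congrArg Complex.im h
    have h2 := congrArg Complex.re h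
    simp at h1 h2
    rcases h1 with h1 | h1
    · simp [h1] at h2
    · linarith
  have hne2 : ∀ t : ℝ, 1 - (t : ℂ) * w ≠ 0 := by
    intro t h
    have h1 := congrArg Complex.im h
    have h2 := congrArg Complex.re h
    simp at h1 h2
    rcases h1 with h1 | h1
    · simp [h1] at h2
    · linarith
  have him : ∀ t : ℝ, 0 < t → ((1 - (t : ℂ) * w) / (1 + t * w)).im < 0 := by
    intro t ht
    have h0 : 0 < Complex.normSq (1 + (t : ℂ) * w) := Complex.normSq_pos.2 (hne1 t)
    rw [Complex.div_im, ← sub_div]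
    refine div_neg_of_neg_of_pos ?_ h0
    simp
    have : 0 < t * w.im := mul_pos ht hw
    nlinarith
  have hslit : ∀ t : ℝ, 0 ≤ t → (1 - (t : ℂ) * w) / (1 + t * w) ∈ Complex.slitPlane := by
    intro t ht
    rcases ht.eq_or_lt with rfl | ht
    · simp
    · exact Or.inr (him t ht).ne
  have hd : ∀ t ∈ Ici (0 : ℝ), HasDerivAt
      (fun t : ℝ => Complex.log ((1 - (t : ℂ) * w) / (1 + t * w)))
      (w • ((-1 - (t * w : ℂ))⁻¹ + ((t * w : ℂ) - 1)⁻¹)) t := by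
    intro t ht
    have h5 : HasDerivAt (fun x : ℝ => (x : ℂ)) 1 t := Complex.ofRealCLM.hasDerivAt
    have h6 := h5.mul_const w
    have h7 : HasDerivAt (fun t : ℝ => Complex.log ((1 - (t : ℂ) * w) / (1 + t * w)))
        ((-(1 * w) * (1 + t * w) - (1 - t * w) * (1 * w)) / (1 + (t : ℂ) * w) ^ 2 /
          ((1 - t * w) / (1 + t * w))) t :=
      ((h6.const_sub 1).div (h6.const_add 1) (hne1 t)).clog_real (hslit t ht)
    convert h7 using 1
    have e1 := hne1 t
    have e2 := hne2 t
    have e3 : (-1 - (t * w : ℂ)) = -(1 + t * w) := by ring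
    have e4 : ((t * w : ℂ) - 1) = -(1 - t * w) := by ring
    rw [e3, e4, inv_neg, inv_neg, smul_eq_mul]
    clear e3 e4 h7 h6 h5
    generalize (t : ℂ) * w = u at *
    field_simp
    ring
  have hlim0 : Tendsto (fun t : ℝ => (1 - (t : ℂ) * w) / (1 + t * w)) atTop (𝓝 (-1)) := by
    have h1 : Tendsto (fun t : ℝ => ((t : ℂ))⁻¹) atTop (𝓝 0) := by
      have := (Complex.continuous_ofReal.tendsto 0).comp tendsto_inv_atTop_zero
      simpa [Function.comp_def] using this
    have h2 : Tendsto (fun t : ℝ => (((t : ℂ))⁻¹ - w) / ((t : ℂ)⁻¹ + w)) atTop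
        (𝓝 ((0 - w) / (0 + w))) :=
      (h1.sub_const w).div (h1.add_const w) (by simpa using hw0)
    have h3 : (0 - w) / (0 + w) = -1 := by rw [zero_sub, zero_add, neg_div, div_self hw0]
    rw [h3] at h2
    refine h2.congr' ?_
    filter_upwards [eventually_gt_atTop 0] with t ht
    have ht' : (t : ℂ) ≠ 0 := by exact_mod_cast ht.ne'
    rw [← mul_div_mul_left _ _ ht', mul_sub, mul_add, mul_inv_cancel₀ ht']
  -- The quotient approaches `-1` from the lower half plane, where `log` tends to `-π i`.
  have hlim : Tendsto (fun t : ℝ => Complex.log ((1 - (t : ℂ) * w) / (1 + t * w))) atTop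
      (𝓝 (Real.log ‖(-1 : ℂ)‖ - Real.pi * Complex.I)) := by
    refine (Complex.tendsto_log_nhdsWithin_im_neg_of_re_neg_of_im_zero (by simp) (by simp)).comp ?_
    refine tendsto_nhdsWithin_iff.2 ⟨hlim0, ?_⟩
    filter_upwards [eventually_gt_atTop 0] with t ht using him t ht
  rw [integral_Ioi_of_hasDerivAt_of_tendsto' hd hint hlim]
  simp

end Kernel

/-! ### The operator associated with a kernel -/

theorem abs_arg_mul_ray {w : ℂ} {t : ℝ} (ht : 0 < t) : |((t : ℂ) * w).arg| = |w.arg| := by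
  rw [Complex.arg_real_mul _ ht]

theorem abs_arg_conj (z : ℂ) : |(starRingEnd ℂ z).arg| = |z.arg| := by
  rw [Complex.arg_conj]
  split_ifs with h
  · rw [h]
  · rw [abs_neg]

/-- The Cauchy kernel `(ζ - z)⁻¹`, corrected by a pole at `1` so that it is integrable along
rays. -/
noncomputable def poleKernel (ζ z : ℂ) : ℂ := (ζ - z)⁻¹ + (z - 1)⁻¹

section Scalar

variable {ν θ α : ℝ} {ζ w : ℂ}

theorem integrableOn_ray_poleKernel (hν : 0 < ν) (hνα : ν < α) (hα : α ≤ Real.pi / 2)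
    (hζ : α ≤ |ζ.arg|) (hw : |w.arg| = ν) :
    IntegrableOn (fun t : ℝ => w • poleKernel ζ (t * w)) (Ioi 0) := by
  have hζ0 : ζ ≠ 0 := by rintro rfl; simp at hζ; linarith
  have hw0 : w ≠ 0 := by rintro rfl; simp at hw; linarith
  obtain ⟨c, hc⟩ := exists_sq_norm_inv_sub_le hνα (by linarith) hζ0 hζ
  obtain ⟨d, -, hd⟩ := exists_sq_norm_inv_sub_one_le hν (by linarith)
  have h : ∀ t : ℝ, 0 < t → |((t : ℂ) * w).arg| = ν := fun t ht => by rw [abs_arg_mul_ray ht, hw]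
  refine integrableOn_ray (s := 1) (c := ‖ζ - 1‖ * ((c + d) / 2)) one_pos hw0 (fun t ht => ?_)
    fun t ht => ?_
  · have h1 := (hc _ (h t ht).le).1
    have h2 := (hd _ (h t ht).ge).1
    unfold poleKernel
    fun_prop (disch := assumption)
  · obtain ⟨h1, h1'⟩ := hc _ (h t ht).le
    obtain ⟨h2, h2'⟩ := hd _ (h t ht).ge
    have : poleKernel ζ (t * w) = (ζ - 1) * ((ζ - t * w)⁻¹ * ((t : ℂ) * w - 1)⁻¹) := by
      unfold poleKernel; field_simp; ring
    rw [this, norm_mul, norm_mul, mul_assoc]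
    exact mul_le_mul_of_nonneg_left (mul_le_of_sq_le h1' h2') (norm_nonneg _)

/-- Rotating the rays within the sector, where both kernels are holomorphic, shows that the
contour integrals for the poles `ζ` and `-1` agree. -/
theorem integral_ray_poleKernel_sub (hν : 0 < ν) (hνθ : ν < θ) (hθα : θ < α)
    (hα : α ≤ Real.pi / 2) (hζ : α ≤ |ζ.arg|) (hw : |w.arg| = ν) {w' : ℂ} (hw' : |w'.arg| = ν) :
    ∫ t in Ioi (0 : ℝ), w • (poleKernel ζ (t * w) - poleKernel (-1) (t * w)) =
      ∫ t in Ioi (0 : ℝ), w' • (poleKernel ζ (t * w') - poleKernel (-1) (t * w')) := by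
  have hpi := Real.pi_pos
  have hζ0 : ζ ≠ 0 := by rintro rfl; simp at hζ; linarith
  have hmem : ∀ x : ℂ, |x.arg| = ν → x ∈ sector θ := fun x hx =>
    ⟨by rintro rfl; simp at hx; linarith, by linarith⟩
  obtain ⟨c, hc⟩ := exists_sq_norm_inv_sub_le hθα (by linarith) hζ0 hζ
  obtain ⟨d, hd⟩ := exists_sq_norm_inv_sub_le (ζ := -1) hθα (by linarith) (by simp)
    (by rw [Complex.arg_neg_one, abs_of_pos hpi]; linarith)
  refine integral_ray_eq (F := fun z => poleKernel ζ z - poleKernel (-1) z) (U := sector θ)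
    (s := 1) (c := ‖-1 - ζ‖ * ((c + d) / 2))
    (isOpen_sector (by linarith) (by linarith)) (fun h => h.1 rfl)
    (isPreconnected_sector (by linarith) (by linarith)) (fun t ht z hz => smul_mem_sector ht hz)
    (fun z hz => ?_) one_pos (fun z hz => ?_) (hmem w hw) (hmem w' hw')
  · have h1 := (hc z hz.2.le).1
    have h2 := (hd z hz.2.le).1
    have : (fun z => poleKernel ζ z - poleKernel (-1) z) = fun z => (ζ - z)⁻¹ - (-1 - z)⁻¹ := by
      ext; unfold poleKernel; ring
    rw [this]
    refine DifferentiableAt.differentiableWithinAt ?_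
    fun_prop (disch := assumption)
  · obtain ⟨h1, h1'⟩ := hc z hz.2.le
    obtain ⟨h2, h2'⟩ := hd z hz.2.le
    have : poleKernel ζ z - poleKernel (-1) z = (-1 - ζ) * ((ζ - z)⁻¹ * (-1 - z)⁻¹) := by
      unfold poleKernel
      rw [add_sub_add_right_eq_sub]
      field_simp; ring
    rw [this, norm_mul, norm_mul, mul_assoc]
    exact mul_le_mul_of_nonneg_left (mul_le_of_sq_le h1' h2') (norm_nonneg _)

theorem integral_contour_poleKernel (hν : 0 < ν) (hνθ : ν < θ) (hθα : θ < α)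
    (hα : α ≤ Real.pi / 2) (hζ : α ≤ |ζ.arg|) (hw : w.arg = ν) :
    (∫ t in Ioi (0 : ℝ), (starRingEnd ℂ w) • poleKernel ζ (t * starRingEnd ℂ w)) -
      ∫ t in Ioi (0 : ℝ), w • poleKernel ζ (t * w) = 2 * Real.pi * Complex.I := by
  have hpi := Real.pi_pos
  have hw0 : w ≠ 0 := by rintro rfl; simp at hw; linarith
  have hw1 : |w.arg| = ν := by rw [hw, abs_of_pos hν]
  have hw2 : |(starRingEnd ℂ w).arg| = ν := by
    rw [abs_arg_conj, hw1]
  have him : 0 < w.im := by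
    rw [← Complex.norm_mul_sin_arg, hw]
    exact mul_pos (norm_pos_iff.2 hw0) (Real.sin_pos_of_pos_of_lt_pi hν (by linarith))
  have hm1 : α ≤ |(-1 : ℂ).arg| := by rw [Complex.arg_neg_one, abs_of_pos hpi]; linarith
  have hνα := hνθ.trans hθα
  have key : ∀ x : ℂ, |x.arg| = ν → ∫ t in Ioi (0 : ℝ), x • poleKernel ζ (t * x) =
      (∫ t in Ioi (0 : ℝ), x • (poleKernel ζ (t * x) - poleKernel (-1) (t * x))) +
        ∫ t in Ioi (0 : ℝ), x • poleKernel (-1) (t * x) := by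
    intro x hx
    simp only [smul_sub]
    rw [integral_sub (integrableOn_ray_poleKernel hν hνα hα hζ hx)
      (integrableOn_ray_poleKernel hν hνα hα hm1 hx), sub_add_cancel]
  have href : ∫ t in Ioi (0 : ℝ), w • poleKernel (-1) (t * w) = -(Real.pi * Complex.I) :=
    integral_ray_reference him (integrableOn_ray_poleKernel hν hνα hα hm1 hw1)
  have href' : ∫ t in Ioi (0 : ℝ), (starRingEnd ℂ w) • poleKernel (-1) (t * starRingEnd ℂ w) =
      Real.pi * Complex.I := by
    have : ∀ t : ℝ, (starRingEnd ℂ w) • poleKernel (-1) (t * starRingEnd ℂ w) =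
        starRingEnd ℂ (w • poleKernel (-1) (t * w)) := by
      intro t; simp [poleKernel]
    simp only [this]
    rw [integral_conj, href]; simp
  rw [key _ hw1, key _ hw2, href, href',
    integral_ray_poleKernel_sub hν hνθ hθα hα hζ hw1 hw2]
  ring

end Scalar

section Operator

variable {X : Type*} [NormedAddCommGroup X] [NormedSpace ℂ X] {A : X →L[ℂ] X}

/-- The function `(ζ - z)⁻¹ - (ζ + z)⁻¹` of `z`. Unlike the Cauchy kernel `(ζ - z)⁻¹` it belongs to
`H^∞_0` of a sector omitting `±ζ`, and its integral over a ray of `ζ`s is bounded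
uniformly in `z`. -/
noncomputable def kernel (ζ z : ℂ) : ℂ := 2 * z / (ζ ^ 2 - z ^ 2)

/-- The defect of the partial fraction expansion of `kernel ζ z • resolvent A z` with poles `ζ`,
`-ζ` and `1`; it is holomorphic to the left of the contour. -/
noncomputable def kernelDefect (A : X →L[ℂ] X) (ζ z : ℂ) : X →L[ℂ] X :=
  (z - 1)⁻¹ • (resolvent A z * (A - 1) * (resolvent A ζ + resolvent A (-ζ)))

theorem kernel_smul_resolvent {z ζ : ℂ} (hz : z ∈ resolventSet ℂ A)
    (hζ : ζ ∈ resolventSet ℂ A) (hζ' : -ζ ∈ resolventSet ℂ A) (h1 : ζ - z ≠ 0)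
    (h2 : -ζ - z ≠ 0) (h3 : z - 1 ≠ 0) :
    kernel ζ z • resolvent A z = kernelDefect A ζ z + (poleKernel ζ z • resolvent A ζ +
      poleKernel (-ζ) z • resolvent A (-ζ)) := by
  have hk : kernel ζ z = (ζ - z)⁻¹ + (-ζ - z)⁻¹ := by
    have h4 : ζ ^ 2 - z ^ 2 = -((ζ - z) * (-ζ - z)) := by ring
    rw [kernel, h4]; field_simp; ring
  have e1 : resolvent A z = resolvent A ζ + (ζ - z) • (resolvent A z * resolvent A ζ) := by
    rw [← resolvent_sub_resolvent_eq hz hζ]; abel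
  have e2 : resolvent A z = resolvent A (-ζ) + (-ζ - z) • (resolvent A z * resolvent A (-ζ)) := by
    rw [← resolvent_sub_resolvent_eq hz hζ']; abel
  have e3 : (ζ - z)⁻¹ • resolvent A z =
      (ζ - z)⁻¹ • resolvent A ζ + resolvent A z * resolvent A ζ := by
    nth_rw 1 [e1]
    rw [smul_add, inv_smul_smul₀ h1]
  have e4 : (-ζ - z)⁻¹ • resolvent A z =
      (-ζ - z)⁻¹ • resolvent A (-ζ) + resolvent A z * resolvent A (-ζ) := by
    nth_rw 1 [e2]
    rw [smul_add, inv_smul_smul₀ h2]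
  have e5 : resolvent A z * (A - 1) = (z - 1) • resolvent A z - 1 := by
    rw [mul_sub, resolvent_mul_self hz, mul_one, sub_smul, one_smul]; abel
  rw [kernelDefect, e5, sub_mul, smul_mul_assoc, smul_sub, inv_smul_smul₀ h3, hk, add_smul, e3, e4,
    poleKernel, poleKernel, one_mul, mul_add]
  module

variable {ν₀ ν θ α C : ℝ}

theorem exists_kernelDefect_bound (hν₀ : 0 < ν₀) (hν₀' : ν₀ ≤ Real.pi / 2) (hC : 0 ≤ C)
    (hA : ∀ z : ℂ, ν₀ < |z.arg| → z ∈ resolventSet ℂ A ∧ ‖resolvent A z‖ ≤ C / ‖z‖)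
    {ζ : ℂ} (hζ : ν₀ < |ζ.arg|) (hζ' : ν₀ < |(-ζ).arg|) :
    ∃ c : ℝ, ∀ z : ℂ, ν₀ < |z.arg| → ‖kernelDefect A ζ z‖ ≤ c * decay 1 ‖z‖ := by
  obtain ⟨d, hd0, hd⟩ := exists_sq_norm_inv_sub_one_le hν₀ hν₀'
  -- The factor `A` in `B = A * Q` cancels the singularity of the resolvent at `0`.
  set B := resolvent A ζ + resolvent A (-ζ) with hB
  set Q := (-2 : ℂ) • (resolvent A ζ * resolvent A (-ζ)) with hQ
  have hBQ : B = A * Q := by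
    rw [hB, resolvent_add_resolvent_neg (hA _ hζ).1 (hA _ hζ').1, hQ, mul_smul_comm]
  set D := max (C * ‖(A - 1) * B‖) ((C + ‖(1 : X →L[ℂ] X)‖) * ‖(A - 1) * Q‖) with hD
  have hD0 : 0 ≤ D := le_max_of_le_left (by positivity)
  refine ⟨(d + 2 * D ^ 2) / 2, fun z hz => ?_⟩
  obtain ⟨hz1, hz2⟩ := hA z hz
  have hz0 : 0 < ‖z‖ := norm_pos_iff.2 (by rintro rfl; simp at hz; linarith)
  have b1 : ‖resolvent A z * (A - 1) * B‖ ≤ D / ‖z‖ := by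
    rw [mul_assoc]
    refine (norm_mul_le _ _).trans ?_
    calc ‖resolvent A z‖ * ‖(A - 1) * B‖ ≤ C / ‖z‖ * ‖(A - 1) * B‖ := by gcongr
      _ = C * ‖(A - 1) * B‖ / ‖z‖ := by ring
      _ ≤ D / ‖z‖ := by gcongr; exact le_max_left _ _
  have b2 : ‖resolvent A z * (A - 1) * B‖ ≤ D := by
    have h1 : resolvent A z * (A - 1) * B = (resolvent A z * A) * ((A - 1) * Q) := by
      rw [hBQ]; noncomm_ring
    have h2 : ‖resolvent A z * A‖ ≤ C + ‖(1 : X →L[ℂ] X)‖ := by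
      rw [resolvent_mul_self hz1]
      refine (norm_sub_le _ _).trans (add_le_add_left ?_ _)
      rw [norm_smul, mul_comm]
      rwa [le_div_iff₀ hz0] at hz2
    rw [h1]
    refine (norm_mul_le _ _).trans (le_trans ?_ (le_max_right _ _))
    gcongr
  have b3 : ‖resolvent A z * (A - 1) * B‖ ^ 2 ≤ (2 * D ^ 2) / (1 + ‖z‖ ^ 2) := by
    rw [le_div_iff₀ (by positivity)]
    rw [le_div_iff₀ hz0] at b1
    have h1 := norm_nonneg (resolvent A z * (A - 1) * B)
    have h2 := pow_le_pow_left₀ h1 b2 2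
    have h3 := pow_le_pow_left₀ (mul_nonneg h1 hz0.le) b1 2
    rw [mul_pow] at h3
    linarith
  rw [kernelDefect, norm_smul]
  exact mul_le_of_sq_le (hd z hz.le).2 b3

/-- The operator associated with `kernel ζ` by the functional calculus. -/
theorem sectorIntegral_kernel [CompleteSpace X] (hν₀ : 0 < ν₀) (hν₀ν : ν₀ < ν) (hνθ : ν < θ)
    (hθα : θ < α) (hα : α ≤ Real.pi / 2) (hC : 0 ≤ C)
    (hA : ∀ z : ℂ, ν₀ < |z.arg| → z ∈ resolventSet ℂ A ∧ ‖resolvent A z‖ ≤ C / ‖z‖)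
    {ζ : ℂ} (hζ : α ≤ |ζ.arg|) (hζ' : α ≤ |(-ζ).arg|) :
    sectorIntegral A ν (kernel ζ) = resolvent A ζ + resolvent A (-ζ) := by
  have hpi := Real.pi_pos
  have hν : 0 < ν := hν₀.trans hν₀ν
  have hνα : ν < α := hνθ.trans hθα
  set w : ℂ := Complex.exp (ν * Complex.I) with hw
  have hww' : Complex.exp (-(ν * Complex.I)) = starRingEnd ℂ w := by
    rw [hw, ← Complex.exp_conj]; simp
  have hwarg : w.arg = ν := arg_exp_mul_I (by linarith) (by linarith)
  have hw1 : |w.arg| = ν := by rw [hwarg, abs_of_pos hν]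
  have hw2 : |(starRingEnd ℂ w).arg| = ν := by rw [abs_arg_conj, hw1]
  have hζ1 := (hA ζ (by linarith)).1
  have hζ2 := (hA (-ζ) (by linarith)).1
  have hne : ∀ x : ℂ, α ≤ |x.arg| → x ≠ 0 := by rintro x hx rfl; simp at hx; linarith
  obtain ⟨c, hc⟩ := exists_kernelDefect_bound (A := A) hν₀ (by linarith) hC hA
    (ζ := ζ) (by linarith) (by linarith)
  have hopen := isOpen_lt_abs_arg hν₀ (by linarith)
  have h0 : (0 : ℂ) ∉ {z : ℂ | ν₀ < |z.arg|} := by simp; linarith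
  obtain ⟨c1, hc1⟩ := exists_sq_norm_inv_sub_le hνα (by linarith) (hne ζ hζ) hζ
  obtain ⟨c2, hc2⟩ := exists_sq_norm_inv_sub_le hνα (by linarith) (hne _ hζ') hζ'
  obtain ⟨d, -, hd⟩ := exists_sq_norm_inv_sub_one_le hν₀ (by linarith)
  have hdiff : DifferentiableOn ℂ (kernelDefect A ζ) {z : ℂ | ν₀ < |z.arg|} := by
    intro z hz
    refine DifferentiableAt.differentiableWithinAt ?_
    have h1 := (hd z (le_of_lt hz)).1
    have h2 := differentiableAt_resolvent (hA z hz).1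
    unfold kernelDefect
    have h3 : DifferentiableAt ℂ (fun z : ℂ => (z - 1)⁻¹) z := by fun_prop (disch := assumption)
    exact h3.smul ((h2.mul_const _).mul_const _)
  -- The defect does not contribute: its two ray integrals agree by rotation to the left.
  have hrot := integral_ray_eq hopen h0
    (isPreconnected_lt_abs_arg hν₀ (by linarith))
    (fun t ht z hz => by
      simp only [mem_ofPred_eq] at *
      rwa [abs_arg_mul_ray ht]) hdiff one_pos hc (z := starRingEnd ℂ w) (w := w)
    (show ν₀ < _ by rw [hw2]; exact hν₀ν) (show ν₀ < _ by rw [hw1]; exact hν₀ν)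
  have hexp : ∀ x : ℂ, |x.arg| = ν →
      ∫ t in Ioi (0 : ℝ), (x * kernel ζ (t * x)) • resolvent A (t * x) =
      (∫ t in Ioi (0 : ℝ), x • kernelDefect A ζ (t * x)) +
        ((∫ t in Ioi (0 : ℝ), x • poleKernel ζ (t * x)) • resolvent A ζ +
        (∫ t in Ioi (0 : ℝ), x • poleKernel (-ζ) (t * x)) • resolvent A (-ζ)) := by
    intro x hx
    have hx0 : x ≠ 0 := by rintro rfl; simp at hx; linarith
    have harg : ∀ t : ℝ, 0 < t → ν₀ < |((t : ℂ) * x).arg| := fun t ht => by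
      rw [abs_arg_mul_ray ht, hx]; exact hν₀ν
    have i1 : IntegrableOn (fun t : ℝ => x • kernelDefect A ζ (t * x)) (Ioi 0) :=
      integrableOn_ray one_pos hx0
        (fun t ht => ((hdiff _ (harg t ht)).differentiableAt
          (hopen.mem_nhds (harg t ht))).continuousAt) fun t ht => hc _ (harg t ht)
    have i2 := (integrableOn_ray_poleKernel hν hνα hα hζ hx).smul_const (resolvent A ζ)
    have i3 := (integrableOn_ray_poleKernel hν hνα hα hζ' hx).smul_const (resolvent A (-ζ))
    have j2 := integral_smul_const (𝕜 := ℂ) (μ := volume.restrict (Ioi (0 : ℝ)))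
      (fun t : ℝ => x • poleKernel ζ (t * x)) (resolvent A ζ)
    have j3 := integral_smul_const (𝕜 := ℂ) (μ := volume.restrict (Ioi (0 : ℝ)))
      (fun t : ℝ => x • poleKernel (-ζ) (t * x)) (resolvent A (-ζ))
    have i4 : IntegrableOn (fun t : ℝ => (x • poleKernel ζ (t * x)) • resolvent A ζ +
      (x • poleKernel (-ζ) (t * x)) • resolvent A (-ζ)) (Ioi 0) := i2.add i3
    rw [← j2, ← j3, ← integral_add i2 i3, ← integral_add i1 i4]
    refine setIntegral_congr_fun measurableSet_Ioi fun t ht => ?_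
    have hle : |((t : ℂ) * x).arg| ≤ ν := by rw [abs_arg_mul_ray ht, hx]
    rw [mul_smul, kernel_smul_resolvent (hA _ (harg t ht)).1 hζ1 hζ2 (hc1 _ hle).1
      (hc2 _ hle).1 (hd _ (harg t ht).le).1, smul_add, smul_add, smul_assoc, smul_assoc]
  have s1 := integral_contour_poleKernel hν hνθ hθα hα hζ hwarg
  have s2 := integral_contour_poleKernel hν hνθ hθα hα hζ' hwarg
  unfold sectorIntegral
  simp only
  rw [← hw, hww', hexp _ hw1, hexp _ hw2, hrot, add_sub_add_left_eq_sub, add_sub_add_comm,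
    ← sub_smul, ← sub_smul, s1, s2, ← smul_add, smul_smul, inv_mul_cancel₀ Complex.two_pi_I_ne_zero,
    one_smul]

end Operator

/-! ### Superpositions of kernels along a ray -/

theorem rpow_mul_rpow_le {a t r : ℝ} (ha : 0 ≤ a) (ha2 : a ≤ 2) (ht : 0 < t) (hr : 0 < r) :
    t ^ a * r ^ (2 - a) ≤ t ^ 2 + r ^ 2 := by
  rcases le_total t r with h | h
  · have h1 : t ^ a ≤ r ^ a := Real.rpow_le_rpow ht.le h ha
    have h2 : r ^ a * r ^ (2 - a) = r ^ 2 := by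
      rw [← Real.rpow_add hr]; norm_num
    have h3 : 0 ≤ r ^ (2 - a) := by positivity
    nlinarith [sq_nonneg t]
  · have h1 : r ^ (2 - a) ≤ t ^ (2 - a) := Real.rpow_le_rpow hr.le h (by linarith)
    have h2 : t ^ a * t ^ (2 - a) = t ^ 2 := by
      rw [← Real.rpow_add ht]; norm_num
    have h3 : 0 ≤ t ^ a := by positivity
    nlinarith [sq_nonneg r]

/-- Weighted comparison of `t² + r²` with a product of powers of `t` and `r`, separating the
variables in the double integrals. -/
theorem rpow_div_le_mul_decay {p t r : ℝ} (hp : 0 < p) (hp1 : p ≤ 1) (ht : 0 < t) (ht1 : t ≤ 1)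
    (hr : 0 < r) : t ^ (2 * p) / (t ^ 2 + r ^ 2) ≤ 2 * (t ^ (p - 1) * decay p r) := by
  have h1 := rpow_mul_rpow_le (a := 1 + p) (by linarith) (by linarith) ht hr
  have h2 := rpow_mul_rpow_le (a := 1 - p) (by linarith) (by linarith) ht hr
  have h3 : t ^ (1 + p) ≤ t ^ (1 - p) := Real.rpow_le_rpow_of_exponent_ge ht ht1 (by linarith)
  have e1 : (2 : ℝ) - (1 + p) = 1 - p := by ring
  have e2 : (2 : ℝ) - (1 - p) = 1 + p := by ring
  rw [e1] at h1
  rw [e2] at h2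
  have h4 : t ^ (1 + p) * r ^ (1 + p) ≤ t ^ 2 + r ^ 2 :=
    (mul_le_mul_of_nonneg_right h3 (by positivity)).trans h2
  have h5 : t ^ (1 + p) * r ^ (1 - p) * (1 + r ^ (2 * p)) ≤ 2 * (t ^ 2 + r ^ 2) := by
    have : r ^ (1 - p) * r ^ (2 * p) = r ^ (1 + p) := by
      rw [← Real.rpow_add hr]; ring_nf
    rw [mul_add, mul_one, mul_assoc _ (r ^ (1 - p)), this]; linarith
  have h6 : t ^ (2 * p) = t ^ (p - 1) * t ^ (1 + p) := by
    rw [← Real.rpow_add ht]; ring_nf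
  have h7 : r ^ (p - 1) * r ^ (1 - p) = 1 := by
    rw [← Real.rpow_add hr]; simp
  have hd : 0 < 1 + r ^ (2 * p) := by positivity
  have hq : 0 < t ^ 2 + r ^ 2 := by positivity
  have e3 : 2 * (t ^ (p - 1) * decay p r) * (t ^ 2 + r ^ 2) =
      t ^ (p - 1) * r ^ (p - 1) * (1 + r ^ (2 * p))⁻¹ * (2 * (t ^ 2 + r ^ 2)) := by
    rw [decay]; ring
  rw [div_le_iff₀ hq, e3]
  calc t ^ (2 * p) = t ^ (p - 1) * r ^ (p - 1) * (1 + r ^ (2 * p))⁻¹ *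
        (t ^ (1 + p) * r ^ (1 - p) * (1 + r ^ (2 * p))) := by
        rw [h6]
        calc _ = t ^ (p - 1) * t ^ (1 + p) * (r ^ (p - 1) * r ^ (1 - p)) *
              ((1 + r ^ (2 * p))⁻¹ * (1 + r ^ (2 * p))) := by
              rw [h7, inv_mul_cancel₀ hd.ne']; ring
          _ = _ := by ring
    _ ≤ _ := by gcongr

theorem integral_poisson_le {r b : ℝ} (hr : 0 < r) (hb : 0 ≤ b) :
    ∫ t in Ioc (0 : ℝ) b, r / (t ^ 2 + r ^ 2) ≤ Real.pi / 2 := by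
  have hd : ∀ t : ℝ, HasDerivAt (fun t => Real.arctan (t / r)) (r / (t ^ 2 + r ^ 2)) t := by
    intro t
    have := ((hasDerivAt_id' t).div_const r).arctan
    convert this using 1
    field_simp
    ring
  rw [← intervalIntegral.integral_of_le hb,
    intervalIntegral.integral_eq_sub_of_hasDerivAt (fun t _ => hd t)
      (Continuous.intervalIntegrable (by fun_prop (disch := intros; positivity)) _ _)]
  simp only [zero_div, Real.arctan_zero, sub_zero]
  exact (Real.arctan_lt_pi_div_two _).le

section KernelBounds

variable {θ α : ℝ} {ζ z : ℂ}

theorem norm_sq_sub_sq_ge (hθα : θ < α) (h0 : 0 < θ) (hα : α ≤ Real.pi / 2) (hζ : α ≤ |ζ.arg|)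
    (hζ' : α ≤ |(-ζ).arg|) (hz : |z.arg| ≤ θ) :
    (1 - Real.cos (α - θ)) * (‖ζ‖ ^ 2 + ‖z‖ ^ 2) ≤ ‖ζ ^ 2 - z ^ 2‖ := by
  have h1 := sq_norm_sub_ge hθα.le (by linarith) hz hζ
  have h2 := sq_norm_sub_ge hθα.le (by linarith) hz hζ'
  have e : ζ ^ 2 - z ^ 2 = -((ζ - z) * (-ζ - z)) := by ring
  rw [norm_neg] at h2
  rw [e, norm_neg, norm_mul]
  have hκ := one_sub_cos_pos (sub_pos.2 hθα) (by linarith)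
  refine le_of_sq_le_sq ?_ (by positivity)
  rw [mul_pow ‖ζ - z‖, sq ((1 - _) * _)]
  exact mul_le_mul h1 h2 (by positivity) (by positivity)

theorem norm_kernel_le (hθα : θ < α) (h0 : 0 < θ) (hα : α ≤ Real.pi / 2) (hζ : α ≤ |ζ.arg|)
    (hζ' : α ≤ |(-ζ).arg|) (hz : |z.arg| ≤ θ) :
    ‖kernel ζ z‖ ≤ 2 / (1 - Real.cos (α - θ)) * (‖z‖ / (‖ζ‖ ^ 2 + ‖z‖ ^ 2)) := by
  have h := norm_sq_sub_sq_ge hθα h0 hα hζ hζ' hz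
  have hκ := one_sub_cos_pos (sub_pos.2 hθα) (by linarith)
  have hζ0 : 0 < ‖ζ‖ := norm_pos_iff.2 (by rintro rfl; simp at hζ; linarith)
  rw [kernel, norm_div, norm_mul, Complex.norm_two, div_mul_div_comm]
  gcongr

theorem sq_sub_sq_ne_zero (hθα : θ < α) (h0 : 0 < θ) (hα : α ≤ Real.pi / 2) (hζ : α ≤ |ζ.arg|)
    (hζ' : α ≤ |(-ζ).arg|) (hz : |z.arg| ≤ θ) : ζ ^ 2 - z ^ 2 ≠ 0 := by
  have h := norm_sq_sub_sq_ge hθα h0 hα hζ hζ' hz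
  have hκ := one_sub_cos_pos (sub_pos.2 hθα) (by linarith)
  have hζ0 : 0 < ‖ζ‖ := norm_pos_iff.2 (by rintro rfl; simp at hζ; linarith)
  intro h1
  rw [h1, norm_zero] at h
  have : 0 < (1 - Real.cos (α - θ)) * (‖ζ‖ ^ 2 + ‖z‖ ^ 2) := by positivity
  linarith

theorem hasDerivAt_kernel (h : ζ ^ 2 - z ^ 2 ≠ 0) :
    HasDerivAt (kernel ζ) (2 * (ζ ^ 2 + z ^ 2) / (ζ ^ 2 - z ^ 2) ^ 2) z := by
  have h1 : HasDerivAt (fun z : ℂ => 2 * z) 2 z := by simpa using (hasDerivAt_id z).const_mul 2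
  have h2 : HasDerivAt (fun z : ℂ => ζ ^ 2 - z ^ 2) (-(2 * z)) z := by
    simpa using (hasDerivAt_pow 2 z).const_sub (ζ ^ 2)
  have h3 := h1.div h2 h
  have e : 2 * (ζ ^ 2 + z ^ 2) / (ζ ^ 2 - z ^ 2) ^ 2 =
      (2 * (ζ ^ 2 - z ^ 2) - 2 * z * -(2 * z)) / (ζ ^ 2 - z ^ 2) ^ 2 := by congr 1; ring
  rw [e]; exact h3

end KernelBounds

/-- The holomorphic function obtained by integrating `kernel` against a density `G` along the
segment from `0` to `b w`. -/
noncomputable def rayTransform (w : ℂ) (b : ℝ) (G : ℝ → ℂ) (z : ℂ) : ℂ :=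
  ∫ t in Ioc (0 : ℝ) b, (w * G t) * kernel (t * w) z

/-- The hypotheses on a density `G` along the segment from `0` to `b w`, where `w` lies outside the
double sector of angle `α` about the real axis: `G` is continuous, bounded by `M`, and vanishes
at `0` to some positive order. -/
structure IsRayDensity (α : ℝ) (w : ℂ) (b M c s : ℝ) (G : ℝ → ℂ) : Prop where
  norm_eq : ‖w‖ = 1
  arg_ge : α ≤ |w.arg|
  arg_neg_ge : α ≤ |(-w).arg|
  nonneg : 0 ≤ b
  le_one : b ≤ 1
  s_pos : 0 < s
  continuousOn : ContinuousOn G (Ioc 0 b)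
  norm_le : ∀ t ∈ Ioc 0 b, ‖G t‖ ≤ M
  norm_le_rpow : ∀ t ∈ Ioc 0 b, ‖G t‖ ≤ c * t ^ s

section RayTransform

variable {θ α b M c s : ℝ} {w : ℂ} {G : ℝ → ℂ}

theorem IsRayDensity.arg_mul_ge (h : IsRayDensity α w b M c s G) {t : ℝ} (ht : 0 < t) :
    α ≤ |((t : ℂ) * w).arg| ∧ α ≤ |(-((t : ℂ) * w)).arg| := by
  rw [← mul_neg, abs_arg_mul_ray ht, abs_arg_mul_ray ht]
  exact ⟨h.arg_ge, h.arg_neg_ge⟩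

theorem IsRayDensity.norm_mul_ray (h : IsRayDensity α w b M c s G) {t : ℝ} (ht : 0 < t) :
    ‖(t : ℂ) * w‖ = t := by
  rw [norm_mul, h.norm_eq, mul_one, Complex.norm_real, Real.norm_of_nonneg ht.le]

theorem IsRayDensity.continuousOn_kernel (h : IsRayDensity α w b M c s G) (h0 : 0 < θ)
    (hθα : θ < α) (hα : α ≤ Real.pi / 2) :
    ContinuousOn (fun q : ℝ × ℂ => (w * G q.1) * kernel (q.1 * w) q.2)
      (Ioc 0 b ×ˢ {z : ℂ | |z.arg| ≤ θ}) := by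
  have hG : ContinuousOn (fun q : ℝ × ℂ => G q.1) (Ioc 0 b ×ˢ {z : ℂ | |z.arg| ≤ θ}) :=
    h.continuousOn.comp continuousOn_fst fun q hq => hq.1
  unfold kernel
  refine (continuousOn_const.mul hG).mul (ContinuousOn.div (by fun_prop) (by fun_prop) ?_)
  intro q hq
  have hq1 := h.arg_mul_ge hq.1.1
  exact sq_sub_sq_ne_zero hθα h0 hα hq1.1 hq1.2 hq.2

/-- The separated bound for the integrand, with the exponent `p = min s 1 / 2`. -/
theorem IsRayDensity.norm_mul_kernel_le (h : IsRayDensity α w b M c s G) (h0 : 0 < θ)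
    (hθα : θ < α) (hα : α ≤ Real.pi / 2) {t : ℝ} (ht : t ∈ Ioc 0 b) {z : ℂ} (hz : |z.arg| ≤ θ)
    (hz0 : z ≠ 0) :
    ‖(w * G t) * kernel (t * w) z‖ ≤ 4 * |c| / (1 - Real.cos (α - θ)) * t ^ (min s 1 / 2 - 1) *
      (‖z‖ * decay (min s 1 / 2) ‖z‖) := by
  have hκ := one_sub_cos_pos (sub_pos.2 hθα) (by linarith)
  obtain ⟨h1, h2⟩ := h.arg_mul_ge ht.1
  have h3 := norm_kernel_le hθα h0 hα h1 h2 hz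
  rw [h.norm_mul_ray ht.1] at h3
  have hr : 0 < ‖z‖ := norm_pos_iff.2 hz0
  -- Half of the order `s` of vanishing is spent on integrability in `t`, the other half on the
  -- decay in `z`.
  set p := min s 1 / 2 with hp
  have hp0 : 0 < p := by have := h.s_pos; positivity
  have hp1 : p ≤ 1 := by have := min_le_right s 1; linarith
  have ht1 : t ≤ 1 := ht.2.trans h.le_one
  have ht0 : 0 < t := ht.1
  have h4 : t ^ s ≤ t ^ (2 * p) := by
    refine Real.rpow_le_rpow_of_exponent_ge ht0 ht1 ?_
    have := min_le_left s 1; linarith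
  have h5 : ‖G t‖ ≤ |c| * t ^ (2 * p) :=
    (h.norm_le_rpow t ht).trans (mul_le_mul (le_abs_self c) h4 (by positivity) (abs_nonneg c))
  have h6 := rpow_div_le_mul_decay hp0 hp1 ht0 ht1 hr
  rw [norm_mul, norm_mul, h.norm_eq, one_mul]
  calc ‖G t‖ * ‖kernel (t * w) z‖ ≤ (|c| * t ^ (2 * p)) *
        (2 / (1 - Real.cos (α - θ)) * (‖z‖ / (t ^ 2 + ‖z‖ ^ 2))) := by gcongr
    _ = 2 * |c| / (1 - Real.cos (α - θ)) * ‖z‖ * (t ^ (2 * p) / (t ^ 2 + ‖z‖ ^ 2)) := by ring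
    _ ≤ 2 * |c| / (1 - Real.cos (α - θ)) * ‖z‖ * (2 * (t ^ (p - 1) * decay p ‖z‖)) := by
        gcongr
    _ = _ := by ring

theorem IsRayDensity.norm_rayTransform_le (h : IsRayDensity α w b M c s G) (h0 : 0 < θ)
    (hθα : θ < α) (hα : α ≤ Real.pi / 2) (hM : 0 ≤ M) {z : ℂ} (hz : z ∈ sector θ) :
    ‖rayTransform w b G z‖ ≤ Real.pi / (1 - Real.cos (α - θ)) * M := by
  have hκ := one_sub_cos_pos (sub_pos.2 hθα) (by linarith)
  have hr : 0 < ‖z‖ := norm_pos_iff.2 hz.1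
  have hcont : Continuous fun t : ℝ => ‖z‖ / (t ^ 2 + ‖z‖ ^ 2) := by
    fun_prop (disch := intros; positivity)
  have hint : IntegrableOn (fun t : ℝ => M * (2 / (1 - Real.cos (α - θ)) *
      (‖z‖ / (t ^ 2 + ‖z‖ ^ 2)))) (Ioc 0 b) :=
    (Continuous.integrableOn_Ioc (by fun_prop))
  calc ‖rayTransform w b G z‖
      ≤ ∫ t in Ioc 0 b, M * (2 / (1 - Real.cos (α - θ)) * (‖z‖ / (t ^ 2 + ‖z‖ ^ 2))) := by
        refine norm_integral_le_of_norm_le hint ?_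
        filter_upwards [ae_restrict_mem measurableSet_Ioc] with t ht
        obtain ⟨h1, h2⟩ := h.arg_mul_ge ht.1
        have h3 := norm_kernel_le hθα h0 hα h1 h2 hz.2.le
        rw [h.norm_mul_ray ht.1] at h3
        rw [norm_mul, norm_mul, h.norm_eq, one_mul]
        exact mul_le_mul (h.norm_le t ht) h3 (norm_nonneg _) hM
    _ = M * (2 / (1 - Real.cos (α - θ))) * ∫ t in Ioc 0 b, ‖z‖ / (t ^ 2 + ‖z‖ ^ 2) := by
        simp only [← mul_assoc]
        rw [integral_const_mul]
    _ ≤ M * (2 / (1 - Real.cos (α - θ))) * (Real.pi / 2) := by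
        gcongr; exact integral_poisson_le hr h.nonneg
    _ = _ := by ring

theorem IsRayDensity.differentiableOn_rayTransform (h : IsRayDensity α w b M c s G) (h0 : 0 < θ)
    (hθα : θ < α) (hα : α ≤ Real.pi / 2) (hM : 0 ≤ M) :
    DifferentiableOn ℂ (rayTransform w b G) (sector θ) := by
  have hκ := one_sub_cos_pos (sub_pos.2 hθα) (by linarith)
  have hpi := Real.pi_pos
  intro z₀ hz₀
  have hr : 0 < ‖z₀‖ := norm_pos_iff.2 hz₀.1
  have hcontz : ∀ z ∈ sector θ, ContinuousOn (fun t : ℝ => (w * G t) * kernel (t * w) z)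
      (Ioc 0 b) := fun z hz =>
    (h.continuousOn_kernel h0 hθα hα).comp (f := fun t : ℝ => (t, z)) (by fun_prop)
      fun t ht => ⟨ht, hz.2.le⟩
  have hb : ∀ t ∈ Ioc 0 b, ∀ z ∈ sector θ,
      ‖(w * G t) * (2 * (((t : ℂ) * w) ^ 2 + z ^ 2) / (((t : ℂ) * w) ^ 2 - z ^ 2) ^ 2)‖ ≤
        M * (2 / (1 - Real.cos (α - θ)) ^ 2 / ‖z‖ ^ 2) := by
    intro t ht z hz
    obtain ⟨h1, h2⟩ := h.arg_mul_ge ht.1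
    have h3 := norm_sq_sub_sq_ge hθα h0 hα h1 h2 hz.2.le
    have hz' : 0 < ‖z‖ := norm_pos_iff.2 hz.1
    rw [h.norm_mul_ray ht.1] at h3
    rw [norm_mul, norm_mul, h.norm_eq, one_mul]
    refine mul_le_mul (h.norm_le t ht) ?_ (norm_nonneg _) hM
    rw [norm_div, norm_mul, norm_pow, Complex.norm_two]
    have h4 : ‖((t : ℂ) * w) ^ 2 + z ^ 2‖ ≤ t ^ 2 + ‖z‖ ^ 2 := by
      refine (norm_add_le _ _).trans ?_
      rw [norm_pow, norm_pow, h.norm_mul_ray ht.1]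
    have h5 : 0 < t ^ 2 + ‖z‖ ^ 2 := by positivity
    calc 2 * ‖((t : ℂ) * w) ^ 2 + z ^ 2‖ / ‖((t : ℂ) * w) ^ 2 - z ^ 2‖ ^ 2
        ≤ 2 * (t ^ 2 + ‖z‖ ^ 2) / ((1 - Real.cos (α - θ)) * (t ^ 2 + ‖z‖ ^ 2)) ^ 2 := by gcongr
      _ = 2 / (1 - Real.cos (α - θ)) ^ 2 / (t ^ 2 + ‖z‖ ^ 2) := by field_simp
      _ ≤ 2 / (1 - Real.cos (α - θ)) ^ 2 / ‖z‖ ^ 2 := by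
          gcongr; linarith [sq_nonneg t]
  have hopen := isOpen_sector h0 (by linarith : θ < Real.pi)
  have hnhds : sector θ ∩ Metric.ball z₀ (‖z₀‖ / 2) ∈ 𝓝 z₀ :=
    inter_mem (hopen.mem_nhds hz₀) (Metric.ball_mem_nhds _ (by positivity))
  have key := hasDerivAt_integral_of_dominated_loc_of_deriv_le
    (μ := volume.restrict (Ioc 0 b)) (F := fun z t => (w * G t) * kernel (t * w) z)
    (F' := fun (z : ℂ) (t : ℝ) => (w * G t) *
      (2 * (((t : ℂ) * w) ^ 2 + z ^ 2) / (((t : ℂ) * w) ^ 2 - z ^ 2) ^ 2))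
    (bound := fun _ => M * (2 / (1 - Real.cos (α - θ)) ^ 2 / (‖z₀‖ / 2) ^ 2)) hnhds
    ?_ ?_ ?_ ?_ ?_ ?_
  · exact key.2.differentiableAt.differentiableWithinAt
  · filter_upwards [hopen.mem_nhds hz₀] with z hz
    exact (hcontz z hz).aestronglyMeasurable measurableSet_Ioc
  · have hint : IntegrableOn (fun t : ℝ => M * (2 / (1 - Real.cos (α - θ)) * ‖z₀‖⁻¹)) (Ioc 0 b) :=
      (Continuous.integrableOn_Ioc (by fun_prop))
    refine hint.mono' ((hcontz z₀ hz₀).aestronglyMeasurable measurableSet_Ioc) ?_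
    filter_upwards [ae_restrict_mem measurableSet_Ioc] with t ht
    obtain ⟨h1, h2⟩ := h.arg_mul_ge ht.1
    have h3 := norm_kernel_le hθα h0 hα h1 h2 hz₀.2.le
    rw [h.norm_mul_ray ht.1] at h3
    rw [norm_mul, norm_mul, h.norm_eq, one_mul]
    refine mul_le_mul (h.norm_le t ht) (h3.trans ?_) (norm_nonneg _) hM
    refine mul_le_mul_of_nonneg_left ?_ (by positivity)
    rw [div_le_iff₀ (by positivity), ← div_eq_inv_mul, le_div_iff₀ hr]
    nlinarith [sq_nonneg t]
  · refine ContinuousOn.aestronglyMeasurable ?_ measurableSet_Ioc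
    refine (continuousOn_const.mul h.continuousOn).mul
      (ContinuousOn.div (by fun_prop) (by fun_prop) fun t ht => ?_)
    obtain ⟨h1, h2⟩ := h.arg_mul_ge ht.1
    exact pow_ne_zero 2 (sq_sub_sq_ne_zero hθα h0 hα h1 h2 hz₀.2.le)
  · filter_upwards [ae_restrict_mem measurableSet_Ioc] with t ht z hz
    refine (hb t ht z hz.1).trans ?_
    have h1 := hz.2
    rw [Metric.mem_ball, dist_eq_norm] at h1
    have h2 : ‖z₀‖ / 2 ≤ ‖z‖ := by
      have := norm_sub_norm_le z₀ z
      rw [norm_sub_rev] at this; linarith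
    gcongr
  · exact (Continuous.integrableOn_Ioc (by fun_prop))
  · filter_upwards [ae_restrict_mem measurableSet_Ioc] with t ht z hz
    obtain ⟨h1, h2⟩ := h.arg_mul_ge ht.1
    exact (hasDerivAt_kernel (sq_sub_sq_ne_zero hθα h0 hα h1 h2 hz.1.2.le)).const_mul _

theorem IsRayDensity.isHInftyZeroSector_rayTransform (h : IsRayDensity α w b M c s G)
    (h0 : 0 < θ) (hθα : θ < α) (hα : α ≤ Real.pi / 2) (hM : 0 ≤ M) :
    IsHInftyZeroSector θ (rayTransform w b G) := by
  have hκ := one_sub_cos_pos (sub_pos.2 hθα) (by linarith)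
  refine ⟨⟨h.differentiableOn_rayTransform h0 hθα hα hM,
    _, fun z hz => h.norm_rayTransform_le h0 hθα hα hM hz⟩, ?_⟩
  set p := min s 1 / 2 with hp
  have hp0 : 0 < p := by have := h.s_pos; positivity
  set J := ∫ t in Ioc 0 b, 4 * |c| / (1 - Real.cos (α - θ)) * t ^ (p - 1) with hJ
  refine ⟨p, |J| + 1, hp0, by positivity, fun z hz => ?_⟩
  have hr : 0 < ‖z‖ := norm_pos_iff.2 hz.1
  have h1 : ‖rayTransform w b G z‖ ≤ J * (‖z‖ * decay p ‖z‖) := by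
    rw [hJ, ← integral_mul_const]
    refine norm_integral_le_of_norm_le
      (((integrableOn_rpow_Ioc hp0 b).const_mul _).mul_const _) ?_
    filter_upwards [ae_restrict_mem measurableSet_Ioc] with t ht
    exact h.norm_mul_kernel_le h0 hθα hα ht hz.2.le hz.1
  have h2 : ‖z‖ * decay p ‖z‖ = ‖z‖ ^ p / (1 + ‖z‖ ^ (2 * p)) := by
    rw [decay, Real.rpow_sub_one hr.ne']; field_simp
  rw [h2] at h1
  refine h1.trans ?_
  gcongr
  linarith [le_abs_self J]

end RayTransform

/-! ### The sectorial calculus of a superposition -/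

section

variable {X : Type*} [NormedAddCommGroup X] [NormedSpace ℂ X] {A : X →L[ℂ] X}
variable {ν₀ ν θ α b M c s C : ℝ} {w : ℂ} {G : ℝ → ℂ}

theorem IsRayDensity.integrable_prod [CompleteSpace X] (h : IsRayDensity α w b M c s G)
    (hν₀ : 0 < ν₀) (hν₀ν : ν₀ < ν) (hνα : ν < α) (hα : α ≤ Real.pi / 2)
    (hA : ∀ z : ℂ, ν₀ < |z.arg| → z ∈ resolventSet ℂ A ∧ ‖resolvent A z‖ ≤ C / ‖z‖)
    {x : ℂ} (hx : |x.arg| = ν) (hx1 : ‖x‖ = 1) :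
    Integrable (fun q : ℝ × ℝ => ((w * G q.1) * kernel (q.1 * w) (q.2 * x)) •
      (x • resolvent A (q.2 * x)))
      ((volume.restrict (Ioc 0 b)).prod (volume.restrict (Ioi 0))) := by
  have hν : 0 < ν := hν₀.trans hν₀ν
  have hκ := one_sub_cos_pos (sub_pos.2 hνα) (by linarith)
  set p := min s 1 / 2 with hp
  have hp0 : 0 < p := by have := h.s_pos; positivity
  have harg : ∀ r : ℝ, 0 < r → |((r : ℂ) * x).arg| = ν := fun r hr => by
    rw [abs_arg_mul_ray hr, hx]
  have hnorm : ∀ r : ℝ, 0 < r → ‖(r : ℂ) * x‖ = r := fun r hr => by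
    rw [norm_mul, hx1, mul_one, Complex.norm_real, Real.norm_of_nonneg hr.le]
  have hcont : ContinuousOn (fun q : ℝ × ℝ => ((w * G q.1) * kernel (q.1 * w) (q.2 * x)) •
      (x • resolvent A (q.2 * x))) (Ioc 0 b ×ˢ Ioi 0) := by
    have hR : ContinuousOn (fun q : ℝ × ℝ => x • resolvent A (q.2 * x)) (Ioc 0 b ×ˢ Ioi 0) := by
      intro q hq
      have h1 : ContinuousAt (resolvent A) ((q.2 : ℂ) * x) :=
        (differentiableAt_resolvent (hA _ (by rw [harg q.2 hq.2]; exact hν₀ν)).1).continuousAt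
      exact ((ContinuousAt.comp (f := fun q : ℝ × ℝ => (q.2 : ℂ) * x) h1
        (by fun_prop)).const_smul x).continuousWithinAt
    have hK : ContinuousOn (fun q : ℝ × ℝ => (w * G q.1) * kernel (q.1 * w) (q.2 * x))
        (Ioc 0 b ×ˢ Ioi 0) :=
      (h.continuousOn_kernel hν hνα hα).comp (f := fun q : ℝ × ℝ => (q.1, (q.2 : ℂ) * x))
        (by fun_prop) fun q hq => ⟨hq.1, (harg q.2 hq.2).le⟩
    exact hK.smul hR
  rw [Measure.prod_restrict]
  have hbd : Integrable (fun q : ℝ × ℝ => (4 * |c| / (1 - Real.cos (α - ν)) * q.1 ^ (p - 1)) *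
      (|C| * decay p q.2)) ((volume.restrict (Ioc 0 b)).prod (volume.restrict (Ioi 0))) :=
    ((integrableOn_rpow_Ioc hp0 b).const_mul _).mul_prod ((integrableOn_decay hp0).const_mul _)
  rw [Measure.prod_restrict] at hbd
  refine hbd.mono' (hcont.aestronglyMeasurable (measurableSet_Ioc.prod measurableSet_Ioi)) ?_
  filter_upwards [ae_restrict_mem (measurableSet_Ioc.prod measurableSet_Ioi)] with q hq
  have hq2 : 0 < q.2 := hq.2
  have hne : (q.2 : ℂ) * x ≠ 0 := norm_pos_iff.1 (by rw [hnorm _ hq2]; exact hq2)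
  have h1 := h.norm_mul_kernel_le hν hνα hα hq.1 (harg q.2 hq2).le hne
  have h2 := (hA _ (by rw [harg q.2 hq2]; exact hν₀ν)).2
  rw [hnorm _ hq2] at h1 h2
  have h3 : C / q.2 ≤ |C| / q.2 := by gcongr; exact le_abs_self C
  rw [norm_smul, norm_smul, hx1, one_mul]
  have hd := decay_nonneg p hq2.le
  have ht : 0 < q.1 := hq.1.1
  calc _ ≤ (4 * |c| / (1 - Real.cos (α - ν)) * q.1 ^ (p - 1) * (q.2 * decay p q.2)) *
        (|C| / q.2) := mul_le_mul h1 (h2.trans h3) (norm_nonneg _) (by positivity)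
    _ = _ := by field_simp

/-- The functional calculus of a superposition of kernels is the superposition of the operators
`resolvent A ζ + resolvent A (-ζ)`. -/
theorem IsRayDensity.sectorIntegral_rayTransform [CompleteSpace X]
    (h : IsRayDensity α w b M c s G)
    (hν₀ : 0 < ν₀) (hν₀ν : ν₀ < ν) (hνθ : ν < θ) (hθα : θ < α) (hα : α ≤ Real.pi / 2)
    (hC : 0 ≤ C)
    (hA : ∀ z : ℂ, ν₀ < |z.arg| → z ∈ resolventSet ℂ A ∧ ‖resolvent A z‖ ≤ C / ‖z‖) :
    sectorIntegral A ν (rayTransform w b G) =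
      ∫ t in Ioc (0 : ℝ) b,
        (w * G t) • (resolvent A (t * w) + resolvent A (-(t * w))) := by
  have hpi := Real.pi_pos
  have hν : 0 < ν := hν₀.trans hν₀ν
  have hνα : ν < α := hνθ.trans hθα
  set u : ℂ := Complex.exp (ν * Complex.I) with hu
  have huu' : Complex.exp (-(ν * Complex.I)) = starRingEnd ℂ u := by
    rw [hu, ← Complex.exp_conj]; simp
  have huarg : u.arg = ν := arg_exp_mul_I (by linarith) (by linarith)
  have hu1 : |u.arg| = ν := by rw [huarg, abs_of_pos hν]
  have hu2 : |(starRingEnd ℂ u).arg| = ν := by rw [abs_arg_conj, hu1]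
  have hun : ‖u‖ = 1 := Complex.norm_exp_ofReal_mul_I ν
  have hun' : ‖starRingEnd ℂ u‖ = 1 := by rw [Complex.norm_conj, hun]
  have hray : ∀ x : ℂ, |x.arg| = ν → ‖x‖ = 1 →
      ∫ r in Ioi (0 : ℝ), (x * rayTransform w b G (r * x)) • resolvent A (r * x) =
        ∫ t in Ioc (0 : ℝ) b, (w * G t) •
          ∫ r in Ioi (0 : ℝ), (x * kernel (t * w) (r * x)) • resolvent A (r * x) := by
    intro x hx hx1
    have hint := h.integrable_prod hν₀ hν₀ν hνα hα hA hx hx1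
    have hswap := integral_integral_swap
      (f := fun t r : ℝ => ((w * G t) * kernel (t * w) (r * x)) • (x • resolvent A (r * x))) hint
    have e1 : ∀ r : ℝ, (x * rayTransform w b G (r * x)) • resolvent A (r * x) =
        ∫ t in Ioc (0 : ℝ) b, ((w * G t) * kernel (t * w) (r * x)) •
          (x • resolvent A (r * x)) := by
      intro r
      have := integral_smul_const (𝕜 := ℂ) (μ := volume.restrict (Ioc (0 : ℝ) b))
        (fun t : ℝ => (w * G t) * kernel (t * w) (r * x)) (x • resolvent A (r * x))
      rw [this, rayTransform, mul_comm x, mul_smul]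
    have e2 : ∀ t : ℝ, (w * G t) •
          ∫ r in Ioi (0 : ℝ), (x * kernel (t * w) (r * x)) • resolvent A (r * x) =
        ∫ r in Ioi (0 : ℝ), ((w * G t) * kernel (t * w) (r * x)) • (x • resolvent A (r * x)) := by
      intro t
      rw [← integral_smul]
      congr 1; ext1 r
      rw [smul_smul, smul_smul]; congr 1; ring
    simp only [e1, e2]
    exact hswap.symm
  have hint : ∀ x : ℂ, |x.arg| = ν → ‖x‖ = 1 → IntegrableOn (fun t : ℝ => (w * G t) •
      ∫ r in Ioi (0 : ℝ), (x * kernel (t * w) (r * x)) • resolvent A (r * x)) (Ioc 0 b) := by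
    intro x hx hx1
    refine (h.integrable_prod hν₀ hν₀ν hνα hα hA hx hx1).integral_prod_left.congr ?_
    refine Eventually.of_forall fun t => ?_
    simp only
    rw [← integral_smul]
    congr 1; ext1 r
    rw [smul_smul, smul_smul]; congr 1; ring
  unfold sectorIntegral
  simp only
  rw [← hu, huu', hray _ hu1 hun, hray _ hu2 hun',
    ← integral_sub (hint _ hu2 hun') (hint _ hu1 hun), ← integral_smul]
  refine setIntegral_congr_fun measurableSet_Ioc fun t ht => ?_
  obtain ⟨h1, h2⟩ := h.arg_mul_ge ht.1
  have key := sectorIntegral_kernel (A := A) hν₀ hν₀ν hνθ hθα hα hC hA h1 h2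
  unfold sectorIntegral at key
  rw [← hu, huu'] at key
  rw [← key, ← smul_sub, smul_comm]

end

/-! ### Stolz domains and the Ritt resolvent estimate -/

theorem isOpen_stolz (γ : ℝ) : IsOpen (stolz γ) := isOpen_interior

theorem convex_stolz (γ : ℝ) : Convex ℝ (stolz γ) := (convex_convexHull ℝ _).interior

theorem ball_subset_stolz (γ : ℝ) : Metric.ball (0 : ℂ) (Real.sin γ) ⊆ stolz γ :=
  interior_maximal ((subset_insert _ _).trans (subset_convexHull ℝ _)) Metric.isOpen_ball

theorem stolz_mono {a b : ℝ} (ha : 0 ≤ a) (hab : a ≤ b) (hb : b ≤ Real.pi / 2) :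
    stolz a ⊆ stolz b :=
  interior_mono (convexHull_mono (insert_subset_insert (Metric.ball_subset_ball
    (Real.sin_le_sin_of_le_of_le_pi_div_two (by linarith [Real.pi_pos]) hb hab))))

theorem hull_subset {γ : ℝ} (h0 : 0 < γ) (h1 : γ < Real.pi / 2) :
    convexHull ℝ (insert (1 : ℂ) (Metric.ball (0 : ℂ) (Real.sin γ))) ⊆
      {z : ℂ | |z.im| * Real.cos γ ≤ (1 - z.re) * Real.sin γ} := by
  have hc : 0 < Real.cos γ := Real.cos_pos_of_mem_Ioo ⟨by linarith, h1⟩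
  have hs : 0 < Real.sin γ := Real.sin_pos_of_pos_of_lt_pi h0 (by linarith)
  refine convexHull_min (insert_subset (by simp) fun z hz => ?_) ?_
  · rw [mem_ball_zero_iff] at hz
    have h3 : (z.re * Real.sin γ + |z.im| * Real.cos γ) ^ 2 ≤ ‖z‖ ^ 2 := by
      rw [Complex.sq_norm, Complex.normSq_apply]
      have h4 : |z.im| * |z.im| = z.im * z.im := abs_mul_abs_self _
      have h5 := Real.sin_sq_add_cos_sq γ
      nlinarith [sq_nonneg (z.re * Real.cos γ - |z.im| * Real.sin γ)]
    have h6 := abs_le_of_sq_le_sq h3 (norm_nonneg z)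
    have := (abs_le.1 h6).2
    simp only [mem_ofPred_eq]
    linarith
  · intro x hx y hy a b ha hb hab
    simp only [mem_ofPred_eq, Complex.add_im, Complex.real_smul, Complex.re_ofReal_mul,
      Complex.im_ofReal_mul, Complex.add_re] at *
    have h2 : |a * x.im + b * y.im| ≤ a * |x.im| + b * |y.im| := by
      refine (abs_add_le _ _).trans ?_
      rw [abs_mul, abs_mul, abs_of_nonneg ha, abs_of_nonneg hb]
    have h3 := mul_le_mul_of_nonneg_right h2 hc.le
    have h4 := mul_le_mul_of_nonneg_left hx ha
    have h5 := mul_le_mul_of_nonneg_left hy hb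
    have h6 : (1 - (a * x.re + b * y.re)) = a * (1 - x.re) + b * (1 - y.re) := by
      linear_combination -hab
    rw [h6]
    linarith

theorem one_sub_mem_sector {γ : ℝ} (h0 : 0 < γ) (h1 : γ < Real.pi / 2) {z : ℂ}
    (hz : z ∈ stolz γ) : 1 - z ∈ sector γ := by
  have hs : 0 < Real.sin γ := Real.sin_pos_of_pos_of_lt_pi h0 (by linarith)
  obtain ⟨ε, hε, hball⟩ := Metric.isOpen_iff.1 (isOpen_stolz γ) z hz
  have h2 : z + ((ε / 2 : ℝ) : ℂ) ∈ Metric.ball z ε := by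
    rw [Metric.mem_ball, dist_eq_norm, add_sub_cancel_left, Complex.norm_real,
      Real.norm_of_nonneg (by positivity)]
    linarith
  have h3 := hull_subset h0 h1 (interior_subset (hball h2))
  simp only [mem_ofPred_eq, Complex.add_im, Complex.ofReal_im, Complex.add_re, Complex.ofReal_re,
    add_zero] at h3
  rw [mem_sector_iff h0 (by linarith)]
  simp only [Complex.sub_im, Complex.one_im, zero_sub, abs_neg, Complex.sub_re, Complex.one_re]
  nlinarith

theorem abs_arg_one_sub_le {γ : ℝ} (h0 : 0 < γ) (h1 : γ < Real.pi / 2) {z : ℂ}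
    (hz : z ∈ closure (stolz γ)) : |(1 - z).arg| ≤ γ := by
  have hcl : IsClosed {z : ℂ | |z.im| * Real.cos γ ≤ (1 - z.re) * Real.sin γ} :=
    isClosed_le (by fun_prop) (by fun_prop)
  have h2 := closure_minimal (interior_subset.trans (hull_subset h0 h1)) hcl hz
  by_contra hc
  rw [not_le, lt_abs_arg_iff h0 (by linarith)] at hc
  simp only [Complex.sub_im, Complex.one_im, zero_sub, abs_neg, Complex.sub_re, Complex.one_re]
    at hc
  simp only [mem_ofPred_eq] at h2
  linarith

theorem one_sub_smul_mem_stolz {γ t : ℝ} (ht : 0 < t) (ht1 : t ≤ 1) {z : ℂ}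
    (hz : 1 - z ∈ stolz γ) : 1 - (t : ℂ) * z ∈ stolz γ := by
  have h1 : (1 : ℂ) ∈ convexHull ℝ (insert (1 : ℂ) (Metric.ball (0 : ℂ) (Real.sin γ))) :=
    subset_convexHull ℝ _ (mem_insert _ _)
  have := Convex.combo_interior_self_mem_interior
    (convex_convexHull ℝ (insert (1 : ℂ) (Metric.ball (0 : ℂ) (Real.sin γ)))) hz h1 ht (sub_nonneg.2 ht1) (by ring)
  have e : t • (1 - z) + (1 - t) • (1 : ℂ) = 1 - (t : ℂ) * z := by
    simp only [Complex.real_smul]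
    push_cast
    ring
  rwa [e] at this

theorem one_mem_closure_stolz {γ : ℝ} (h0 : 0 < γ) (h1 : γ < Real.pi / 2) :
    (1 : ℂ) ∈ closure (stolz γ) := by
  have hs : 0 < Real.sin γ := Real.sin_pos_of_pos_of_lt_pi h0 (by linarith)
  rw [stolz, (convex_convexHull ℝ _).closure_interior_eq_closure_of_nonempty_interior
    ⟨0, ball_subset_stolz γ (by simpa using hs)⟩]
  exact subset_closure (subset_convexHull ℝ _ (mem_insert _ _))

theorem one_sub_mem_stolz_of_norm {γ s : ℝ} (hs : 1 ≤ s) {z : ℂ}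
    (hz : ‖1 - (s : ℂ) * z‖ < Real.sin γ) : 1 - z ∈ stolz γ := by
  have h := one_sub_smul_mem_stolz (γ := γ) (t := s⁻¹) (by positivity) (inv_le_one_of_one_le₀ hs)
    (ball_subset_stolz γ (by simpa using hz))
  have hs' : (s : ℂ) ≠ 0 := by exact_mod_cast (by positivity : s ≠ 0)
  rwa [Complex.ofReal_inv, inv_mul_cancel_left₀ hs'] at h

theorem one_sub_mem_stolz_of_norm_le {θ α : ℝ} (h0 : 0 ≤ θ) (hθα : θ < α) (hα : α < Real.pi / 2)
    {z : ℂ} (hz0 : z ≠ 0) (hz : |z.arg| ≤ θ) (hzn : ‖z‖ ≤ Real.cos α) : 1 - z ∈ stolz α := by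
  have hr : 0 < ‖z‖ := norm_pos_iff.2 hz0
  have hc : 0 < Real.cos α := Real.cos_pos_of_mem_Ioo ⟨by linarith, hα⟩
  have hs : 0 < Real.sin α := Real.sin_pos_of_pos_of_lt_pi (by linarith) (by linarith)
  -- Scaling `z` to length `cos α` moves `1 - z` away from `1`, into the disc of radius `sin α`.
  refine one_sub_mem_stolz_of_norm (s := Real.cos α / ‖z‖) ((one_le_div hr).2 hzn) ?_
  refine lt_of_pow_lt_pow_left₀ 2 hs.le ?_
  have hcos : Real.cos α < Real.cos z.arg := by
    rw [← Real.cos_abs z.arg]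
    exact Real.cos_lt_cos_of_nonneg_of_le_pi (abs_nonneg _) (by linarith) (by linarith)
  have h1 : ‖1 - ((Real.cos α / ‖z‖ : ℝ) : ℂ) * z‖ ^ 2 =
      1 - 2 * Real.cos α * Real.cos z.arg + Real.cos α ^ 2 := by
    have e1 := Complex.norm_mul_cos_arg z
    have e2 := Complex.norm_mul_sin_arg z
    rw [Complex.sq_norm, Complex.normSq_apply]
    simp only [Complex.sub_re, Complex.sub_im, Complex.one_re, Complex.one_im,
      Complex.re_ofReal_mul, Complex.im_ofReal_mul]
    rw [← e1, ← e2]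
    have e3 := Real.sin_sq_add_cos_sq z.arg
    field_simp
    linear_combination Real.cos α ^ 2 * e3
  rw [h1, Real.sin_sq]
  nlinarith

section Ritt

variable {X : Type*} [NormedAddCommGroup X] [NormedSpace ℂ X] [CompleteSpace X] {T : X →L[ℂ] X}

/-- The spectral mapping theorem for `z^n - z^(n-1)` shows that the spectrum of a Ritt operator
meets the complement of the open unit disc in at most the point `1`. -/
theorem IsRitt.eq_one_or_norm_lt_one (hT : IsRitt T) {z : ℂ} (hz : z ∈ spectrum ℂ T) :
    z = 1 ∨ ‖z‖ < 1 := by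
  obtain ⟨C, hC⟩ := hT.2
  by_contra! hcon
  obtain ⟨hz1, hz2⟩ := hcon
  have hz1' : 0 < ‖z - 1‖ := norm_pos_iff.2 (sub_ne_zero.2 hz1)
  have key : ∀ n : ℕ, 1 ≤ n → (n : ℝ) * ‖z - 1‖ ≤ C * ‖(1 : X →L[ℂ] X)‖ := by
    intro n hn
    have h1 := spectrum.subset_polynomial_aeval T
      (Polynomial.C (n : ℂ) * (Polynomial.X ^ n - Polynomial.X ^ (n - 1))) ⟨z, hz, rfl⟩
    simp only [Polynomial.eval_mul, Polynomial.eval_C, Polynomial.eval_sub, Polynomial.eval_pow,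
      Polynomial.eval_X, map_mul, Polynomial.aeval_C, map_sub, map_pow, Polynomial.aeval_X] at h1
    rw [← Algebra.smul_def] at h1
    have h2 := (spectrum.norm_le_norm_mul_of_mem h1).trans
      (mul_le_mul_of_nonneg_right (hC n hn) (norm_nonneg _))
    refine le_trans ?_ h2
    have h3 : z ^ n - z ^ (n - 1) = z ^ (n - 1) * (z - 1) := by
      rw [mul_sub, mul_one, ← pow_succ, Nat.sub_add_cancel hn]
    rw [h3, norm_mul, norm_mul, norm_pow, Complex.norm_natCast]
    have h4 : 1 ≤ ‖z‖ ^ (n - 1) := one_le_pow₀ hz2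
    have h5 : ‖z - 1‖ ≤ ‖z‖ ^ (n - 1) * ‖z - 1‖ := le_mul_of_one_le_left hz1'.le h4
    gcongr
  obtain ⟨n, hn⟩ := exists_nat_gt (C * ‖(1 : X →L[ℂ] X)‖ / ‖z - 1‖)
  rw [div_lt_iff₀ hz1'] at hn
  have h1 := key (n + 1) (by omega)
  push_cast at h1
  linarith

theorem exists_bound_of_isClosed {S : Set ℂ} (hS : IsClosed S) (hST : S ⊆ resolventSet ℂ T) :
    ∃ C : ℝ, ∀ z ∈ S, ‖(z - 1) • resolvent T z‖ ≤ C := by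
  obtain ⟨c, hc⟩ := (spectrum.resolvent_isBigO_inv (𝕜 := ℂ) T).bound
  obtain ⟨ρ, -, hρ⟩ := (hasBasis_cobounded_norm (E := ℂ)).eventually_iff.1 hc
  have hcompact : IsCompact (S ∩ Metric.closedBall 0 (max ρ 1)) :=
    (isCompact_closedBall _ _).inter_left hS
  have hcont : ContinuousOn (fun z : ℂ => (z - 1) • resolvent T z)
      (S ∩ Metric.closedBall 0 (max ρ 1)) := fun z hz =>
    ((continuousAt_id.sub continuousAt_const).smul
      (differentiableAt_resolvent (hST hz.1)).continuousAt).continuousWithinAt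
  obtain ⟨C, hC⟩ := hcompact.exists_bound_of_continuousOn hcont
  refine ⟨max C (2 * |c|), fun z hz => ?_⟩
  by_cases h : ‖z‖ ≤ max ρ 1
  · exact (hC z ⟨hz, by simpa using h⟩).trans (le_max_left _ _)
  · rw [not_le, max_lt_iff] at h
    refine le_trans ?_ (le_max_right _ _)
    have h1 := hρ (show z ∈ {x | ρ ≤ ‖x‖} from h.1.le)
    have h0 : 0 < ‖z‖ := by linarith
    rw [norm_smul]
    have h2 : ‖z - 1‖ ≤ 2 * ‖z‖ := by
      have := norm_sub_le z 1
      rw [norm_one] at this; linarith [h.2]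
    rw [norm_inv] at h1
    calc ‖z - 1‖ * ‖resolvent T z‖ ≤ (2 * ‖z‖) * (|c| * ‖z‖⁻¹) := by
          gcongr
          exact h1.trans (by gcongr; exact le_abs_self c)
      _ = 2 * |c| := by field_simp

/-- A Ritt operator `T` for which `1 - T` is sectorial of type less than `π / 2` satisfies the Ritt
resolvent estimate outside some Stolz domain: near `1` the estimate is that for `1 - T`, and away
from `1` the spectrum of `T` is a compact subset of the open unit disc. -/
theorem IsRitt.exists_stolz_bound (hT : IsRitt T) {θ C : ℝ} (h0 : 0 < θ) (h1 : θ < Real.pi / 2)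
    (hA : ∀ z : ℂ, θ < |z.arg| → z ∈ resolventSet ℂ (ContinuousLinearMap.id ℂ X - T) ∧
      ‖resolvent (ContinuousLinearMap.id ℂ X - T) z‖ ≤ C / ‖z‖) :
    ∃ α ∈ Ioo θ (Real.pi / 2), ∃ C₁ : ℝ, ∀ z ∉ closure (stolz α),
      z ∈ resolventSet ℂ T ∧ ‖(z - 1) • resolvent T z‖ ≤ C₁ := by
  set α₁ := (θ + Real.pi / 2) / 2 with hα₁
  have hε : 0 < Real.cos α₁ := Real.cos_pos_of_mem_Ioo ⟨by linarith, by linarith⟩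
  have hclosed : IsClosed {z : ℂ | Real.cos α₁ ≤ ‖1 - z‖} :=
    isClosed_le (by fun_prop) (by fun_prop)
  obtain ⟨r, hr0, hr1, hr⟩ : ∃ r : ℝ, 0 ≤ r ∧ r < 1 ∧
      ∀ z ∈ spectrum ℂ T, Real.cos α₁ ≤ ‖1 - z‖ → ‖z‖ ≤ r := by
    have hK : IsCompact (spectrum ℂ T ∩ {z : ℂ | Real.cos α₁ ≤ ‖1 - z‖}) :=
      (spectrum.isCompact T).inter_right hclosed
    rcases (spectrum ℂ T ∩ {z : ℂ | Real.cos α₁ ≤ ‖1 - z‖}).eq_empty_or_nonempty with he | he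
    · refine ⟨0, le_rfl, one_pos, fun z hz hz' => ?_⟩
      have : z ∈ spectrum ℂ T ∩ {z : ℂ | Real.cos α₁ ≤ ‖1 - z‖} := ⟨hz, hz'⟩
      rw [he] at this; exact this.elim
    · obtain ⟨x, hx, hmax⟩ := hK.exists_isMaxOn he continuous_norm.continuousOn
      refine ⟨‖x‖, norm_nonneg _, ?_, fun z hz hz' => hmax ⟨hz, hz'⟩⟩
      refine (hT.eq_one_or_norm_lt_one hx.1).resolve_left ?_
      rintro rfl
      have := hx.2
      simp at this; linarith
  -- The angle `α` is so large that the disc of radius `sin α` contains the part of the spectrum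
  -- away from `1`, with room to spare.
  set r' := (r + 1) / 2 with hr'
  set α := max α₁ (Real.arcsin r') with hα
  have harcsin : Real.arcsin r' < Real.pi / 2 := Real.arcsin_lt_pi_div_two.2 (by linarith)
  have hα2 : α < Real.pi / 2 := max_lt (by linarith) harcsin
  have hα₁α : α₁ ≤ α := le_max_left _ _
  have hsin : r' ≤ Real.sin α := by
    rw [← Real.sin_arcsin (x := r') (by linarith) (by linarith)]
    exact Real.sin_le_sin_of_le_of_le_pi_div_two (Real.neg_pi_div_two_le_arcsin _) hα2.le
      (le_max_right _ _)
  obtain ⟨C₂, hC₂⟩ := exists_bound_of_isClosed (T := T)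
    (S := {z : ℂ | Real.cos α₁ ≤ ‖1 - z‖} ∩ {z : ℂ | r' ≤ ‖z‖})
    (hclosed.inter (isClosed_le (by fun_prop) (by fun_prop))) (fun z hz => by
      by_contra hc
      have h2 := hr z hc hz.1
      have h3 : r' ≤ ‖z‖ := hz.2
      linarith)
  refine ⟨α, ⟨by linarith, hα2⟩, max C C₂, fun z hz => ?_⟩
  have hz' : 1 - (1 - z) = z := by ring
  by_cases harg : θ < |(1 - z).arg|
  · obtain ⟨h3, h4⟩ := hA _ harg
    have hne : 0 < ‖1 - z‖ := norm_pos_iff.2 (by intro h; rw [h] at harg; simp at harg; linarith)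
    rw [← mem_resolventSet_one_sub, hz'] at h3
    refine ⟨h3, le_trans ?_ (le_max_left _ _)⟩
    have h5 := resolvent_one_sub T (1 - z)
    rw [hz'] at h5
    rw [h5, norm_smul, norm_neg, norm_sub_rev, mul_comm]
    rwa [le_div_iff₀ hne] at h4
  · rw [not_lt] at harg
    have hne : 1 - z ≠ 0 := by
      intro h
      rw [sub_eq_zero] at h
      exact hz (h ▸ one_mem_closure_stolz (by linarith) hα2)
    have h3 : Real.cos α₁ ≤ ‖1 - z‖ := by
      by_contra hc
      have h4 := one_sub_mem_stolz_of_norm_le h0.le (by linarith) (by linarith) hne harg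
        (not_le.1 hc).le
      rw [hz'] at h4
      exact hz (subset_closure (stolz_mono (by linarith) hα₁α hα2.le h4))
    have h4 : r' ≤ ‖z‖ := by
      by_contra hc
      refine hz (subset_closure (ball_subset_stolz α ?_))
      rw [mem_ball_zero_iff]
      linarith
    refine ⟨?_, (hC₂ z ⟨h3, h4⟩).trans (le_max_right _ _)⟩
    by_contra hc
    have h5 := hr z hc h3
    linarith

end Ritt

/-! ### The boundary of a Stolz domain -/

theorem hull_subset_closedBall (γ : ℝ) :
    convexHull ℝ (insert (1 : ℂ) (Metric.ball (0 : ℂ) (Real.sin γ))) ⊆ Metric.closedBall 0 1 := by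
  refine convexHull_min (insert_subset (by simp) ?_) (convex_closedBall _ _)
  exact Metric.ball_subset_closedBall.trans
    (Metric.closedBall_subset_closedBall (Real.sin_le_one γ))

theorem re_pos_of_mem_sector {γ : ℝ} (h0 : 0 < γ) (h1 : γ < Real.pi / 2) {z : ℂ}
    (hz : z ∈ sector γ) : 0 < z.re := by
  rw [mem_sector_iff h0 (by linarith)] at hz
  have hc : 0 < Real.cos γ := Real.cos_pos_of_mem_Ioo ⟨by linarith, h1⟩
  have hs : 0 < Real.sin γ := Real.sin_pos_of_pos_of_lt_pi h0 (by linarith)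
  have h2 : 0 < z.re * Real.sin γ := lt_of_le_of_lt (by positivity) hz
  exact pos_of_mul_pos_left h2 hs.le

theorem lt_abs_arg_neg {a : ℝ} (h0 : 0 < a) (h1 : a < Real.pi / 2) {z : ℂ} (hz : 0 < z.re) :
    a < |(-z).arg| := by
  rw [lt_abs_arg_iff h0 (by linarith), Complex.neg_re, Complex.neg_im, abs_neg]
  have hc : 0 < Real.cos a := Real.cos_pos_of_mem_Ioo ⟨by linarith, h1⟩
  have hs : 0 < Real.sin a := Real.sin_pos_of_pos_of_lt_pi h0 (by linarith)
  have h2 : 0 < z.re * Real.sin a := mul_pos hz hs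
  have h3 : 0 ≤ |z.im| * Real.cos a := by positivity
  linarith

theorem cos_le_sin_of_mem_arc {β t : ℝ} (h1 : β < Real.pi / 2)
    (ht : t ∈ Icc (Real.pi / 2 - β) (3 * Real.pi / 2 + β)) : Real.cos t ≤ Real.sin β := by
  have h2 : Real.cos t = -Real.cos |t - Real.pi| := by
    rw [Real.cos_abs, Real.cos_sub_pi]; ring
  have h3 : Real.sin β = -Real.cos (Real.pi / 2 + β) := by
    rw [add_comm, Real.cos_add_pi_div_two]; ring
  have h4 : |t - Real.pi| ≤ Real.pi / 2 + β := abs_le.2 ⟨by linarith [ht.1], by linarith [ht.2]⟩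
  rw [h2, h3]
  exact neg_le_neg (Real.cos_le_cos_of_nonneg_of_le_pi (abs_nonneg _) (by linarith) h4)

/-- The arc in the boundary of `stolz β` stays away from smaller Stolz domains: in its interior it
is separated from them by the tangent line, and its end points lie on the rays of angle `β`. -/
theorem arc_notMem_closure_stolz {α β t : ℝ} (h0 : 0 < α) (hαβ : α < β) (hβ : β < Real.pi / 2)
    (ht : t ∈ Icc (Real.pi / 2 - β) (3 * Real.pi / 2 + β)) :
    (Real.sin β * Complex.exp (t * Complex.I) : ℂ) ∉ closure (stolz α) := by
  have hsβ : 0 < Real.sin β := Real.sin_pos_of_pos_of_lt_pi (by linarith) (by linarith)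
  have hcβ : 0 < Real.cos β := Real.cos_pos_of_mem_Ioo ⟨by linarith, hβ⟩
  have hre : (Real.sin β * Complex.exp (t * Complex.I) : ℂ).re = Real.sin β * Real.cos t := by
    rw [Complex.re_ofReal_mul, Complex.exp_ofReal_mul_I_re]
  have him : (Real.sin β * Complex.exp (t * Complex.I) : ℂ).im = Real.sin β * Real.sin t := by
    rw [Complex.im_ofReal_mul, Complex.exp_ofReal_mul_I_im]
  intro hmem
  rcases (cos_le_sin_of_mem_arc hβ ht).lt_or_eq with hlt | heq
  · set m := max (Real.sin α) (Real.cos t)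
    have hm : m < Real.sin β := max_lt
      (Real.sin_lt_sin_of_lt_of_le_pi_div_two (by linarith) hβ.le hαβ) hlt
    have hsub : convexHull ℝ (insert (1 : ℂ) (Metric.ball (0 : ℂ) (Real.sin α))) ⊆
        {z : ℂ | z.re * Real.cos t + z.im * Real.sin t ≤ m} := by
      refine convexHull_min (insert_subset ?_ fun z hz => ?_) ?_
      · simp [m]
      · rw [mem_ball_zero_iff] at hz
        have h3 : (z.re * Real.cos t + z.im * Real.sin t) ^ 2 ≤ ‖z‖ ^ 2 := by
          rw [Complex.sq_norm, Complex.normSq_apply]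
          have h5 := Real.sin_sq_add_cos_sq t
          nlinarith [sq_nonneg (z.re * Real.sin t - z.im * Real.cos t)]
        have h6 := (abs_le.1 (abs_le_of_sq_le_sq h3 (norm_nonneg z))).2
        exact h6.trans (hz.le.trans (le_max_left _ _))
      · intro x hx y hy a b ha hb hab
        simp only [mem_ofPred_eq, Complex.add_im, Complex.real_smul, Complex.re_ofReal_mul,
          Complex.im_ofReal_mul, Complex.add_re] at *
        have h4 := mul_le_mul_of_nonneg_left hx ha
        have h5 := mul_le_mul_of_nonneg_left hy hb
        have h6 : m = a * m + b * m := by linear_combination (-m) * hab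
        rw [h6]
        linarith
    have hcl : IsClosed {z : ℂ | z.re * Real.cos t + z.im * Real.sin t ≤ m} :=
      isClosed_le (by fun_prop) (by fun_prop)
    have h7 := closure_minimal (interior_subset.trans hsub) hcl hmem
    rw [mem_ofPred_eq, hre, him] at h7
    have h8 : Real.sin β * Real.cos t * Real.cos t + Real.sin β * Real.sin t * Real.sin t =
        Real.sin β := by
      linear_combination Real.sin β * Real.sin_sq_add_cos_sq t
    linarith
  · have h1 := abs_arg_one_sub_le h0 (by linarith) hmem
    rw [← not_lt, lt_abs_arg_iff h0 (by linarith), Complex.sub_re, Complex.sub_im, hre, him,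
      Complex.one_re, Complex.one_im, zero_sub, abs_neg, abs_mul, abs_of_pos hsβ, heq] at h1
    have h2 : |Real.sin t| = Real.cos β := by
      rw [← abs_of_pos hcβ, ← sq_eq_sq_iff_abs_eq_abs, Real.sin_sq, heq, Real.cos_sq']
    have h3 : 1 - Real.sin β * Real.sin β = Real.cos β * Real.cos β := by
      linear_combination -Real.sin_sq_add_cos_sq β
    rw [h2, h3] at h1
    apply h1
    have h4 : 0 < Real.sin (β - α) := Real.sin_pos_of_pos_of_lt_pi (by linarith) (by linarith)
    rw [Real.sin_sub] at h4
    nlinarith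

theorem norm_one_sub_cos_mul {β : ℝ} (hs : 0 ≤ Real.sin β) {x : ℂ} (hx : ‖x‖ = 1)
    (hre : x.re = Real.cos β) : ‖1 - (Real.cos β : ℂ) * x‖ = Real.sin β := by
  rw [← sq_eq_sq₀ (norm_nonneg _) hs, Complex.sq_norm, Complex.normSq_apply]
  have h1 : x.re * x.re + x.im * x.im = 1 := by
    rw [← Complex.normSq_apply, ← Complex.sq_norm, hx, one_pow]
  simp only [Complex.sub_re, Complex.sub_im, Complex.one_re, Complex.one_im,
      Complex.re_ofReal_mul, Complex.im_ofReal_mul]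
  rw [Real.sin_sq]
  linear_combination Real.cos β ^ 2 * h1 - 2 * Real.cos β * hre

/-- The segments in the boundary of `stolz β` lie in larger Stolz domains. -/
theorem one_sub_ray_mem_stolz {β γ t : ℝ} (h0 : 0 < β) (hβγ : β < γ) (hγ : γ < Real.pi / 2)
    {x : ℂ} (hx : ‖x‖ = 1) (hre : x.re = Real.cos β) (ht : t ∈ Ioc 0 (Real.cos β)) :
    1 - (t : ℂ) * x ∈ stolz γ := by
  have hs : 0 < Real.sin β := Real.sin_pos_of_pos_of_lt_pi h0 (by linarith)
  refine one_sub_mem_stolz_of_norm (s := Real.cos β / t) ((one_le_div ht.1).2 ht.2) ?_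
  have ht0 : (t : ℂ) ≠ 0 := by exact_mod_cast ht.1.ne'
  have e : ((Real.cos β / t : ℝ) : ℂ) * (t * x) = (Real.cos β : ℂ) * x := by
    push_cast; field_simp
  rw [e, norm_one_sub_cos_mul hs.le hx hre]
  exact Real.sin_lt_sin_of_lt_of_le_pi_div_two (by linarith) hγ.le hβγ

theorem norm_le_supNorm {Ω : Set ℂ} {f : ℂ → ℂ} (hf : IsHInfty Ω f) {z : ℂ} (hz : z ∈ Ω) :
    ‖f z‖ ≤ supNorm Ω f := by
  obtain ⟨M, hM⟩ := hf.2
  exact le_ciSup (f := fun z : Ω => ‖f z‖) ⟨M, by rintro _ ⟨x, rfl⟩; exact hM x x.2⟩ ⟨z, hz⟩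

theorem supNorm_nonneg (Ω : Set ℂ) (f : ℂ → ℂ) : 0 ≤ supNorm Ω f :=
  Real.iSup_nonneg fun _ => norm_nonneg _

theorem supNorm_le {Ω : Set ℂ} {f : ℂ → ℂ} {M : ℝ} (hM : 0 ≤ M) (h : ∀ z ∈ Ω, ‖f z‖ ≤ M) :
    supNorm Ω f ≤ M :=
  Real.iSup_le (fun z => h z z.2) hM

section

variable {X : Type*} [NormedAddCommGroup X] [NormedSpace ℂ X] {T : X →L[ℂ] X}

/-- The Stolz contour integral in terms of the resolvent of `1 - T`. -/
theorem stolzIntegral_eq (T : X →L[ℂ] X) {β : ℝ} (hβ : 0 ≤ Real.cos β) (φ : ℂ → ℂ) :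
    stolzIntegral T β φ = (2 * Real.pi * Complex.I : ℂ)⁻¹ •
      ((∫ t in Ioc (0 : ℝ) (Real.cos β), (starRingEnd ℂ (Complex.exp (β * Complex.I)) *
          φ (1 - t * starRingEnd ℂ (Complex.exp (β * Complex.I)))) •
          resolvent (ContinuousLinearMap.id ℂ X - T)
            (t * starRingEnd ℂ (Complex.exp (β * Complex.I)))) -
        (∫ t in Ioc (0 : ℝ) (Real.cos β), (Complex.exp (β * Complex.I) *
          φ (1 - t * Complex.exp (β * Complex.I))) •
          resolvent (ContinuousLinearMap.id ℂ X - T) (t * Complex.exp (β * Complex.I))) +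
        ∫ t in (Real.pi / 2 - β)..(3 * Real.pi / 2 + β),
          (Complex.I * (Real.sin β * Complex.exp (t * Complex.I)) *
            φ (Real.sin β * Complex.exp (t * Complex.I))) •
            resolvent T (Real.sin β * Complex.exp (t * Complex.I))) := by
  have hw : Complex.exp (-(β * Complex.I)) = starRingEnd ℂ (Complex.exp (β * Complex.I)) := by
    rw [← Complex.exp_conj]; simp
  unfold stolzIntegral
  simp only
  rw [hw]
  congr 1
  simp only [resolvent_one_sub, neg_mul, neg_smul, smul_neg, neg_neg]
  rw [intervalIntegral.integral_symm 0 (Real.cos β), intervalIntegral.integral_of_le hβ,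
    intervalIntegral.integral_of_le hβ]
  abel

variable [CompleteSpace X]

/-- The part of the contour integral along the segments that involves `resolvent A (-z)`, where
`A = 1 - T`, is bounded in terms of the supremum of `φ`: the integrand is holomorphic inside the
contour, so that the segments may be replaced by a chord away from `1`. -/
theorem norm_segment_sub_le {ν₀ β γ C : ℝ} {A : X →L[ℂ] X} (hν₀ : 0 < ν₀) (hν₀' : ν₀ < Real.pi / 2)
    (hβ : 0 < β) (hβγ : β < γ) (hγ : γ < Real.pi / 2) (hC : 0 ≤ C)
    (hA : ∀ z : ℂ, ν₀ < |z.arg| → z ∈ resolventSet ℂ A ∧ ‖resolvent A z‖ ≤ C / ‖z‖)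
    {φ : ℂ → ℂ} (hφ : IsHInftyZeroStolz γ φ) {x y : ℂ} (hx : ‖x‖ = 1) (hy : ‖y‖ = 1)
    (hxre : x.re = Real.cos β) (hyre : y.re = Real.cos β) :
    ‖(∫ t in Ioc (0 : ℝ) (Real.cos β), (x * φ (1 - t * x)) • resolvent A (-(t * x))) -
      ∫ t in Ioc (0 : ℝ) (Real.cos β), (y * φ (1 - t * y)) • resolvent A (-(t * y))‖ ≤
      2 * (C / Real.cos γ ^ 2) * supNorm (stolz γ) φ := by
  have hγ0 : 0 < γ := hβ.trans hβγ
  have hcγ : 0 < Real.cos γ := Real.cos_pos_of_mem_Ioo ⟨by linarith, hγ⟩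
  have hcβ : 0 < Real.cos β := Real.cos_pos_of_mem_Ioo ⟨by linarith, by linarith⟩
  have hcos : Real.cos γ ≤ Real.cos β :=
    Real.cos_le_cos_of_nonneg_of_le_pi hβ.le (by linarith) hβγ.le
  set M := supNorm (stolz γ) φ with hM
  have hM0 : 0 ≤ M := supNorm_nonneg _ _
  obtain ⟨hφ1, s, c, hs, hc, hφ2⟩ := hφ
  set U : Set ℂ := {z | 1 - z ∈ stolz γ} with hU
  have hUopen : IsOpen U := (isOpen_stolz γ).preimage (by fun_prop)
  have hUsec : ∀ z ∈ U, z ∈ sector γ := fun z hz => by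
    have := one_sub_mem_sector hγ0 hγ hz
    rwa [sub_sub_cancel] at this
  have h0U : (0 : ℂ) ∉ U := fun h => (hUsec 0 h).1 rfl
  have hres : ∀ z ∈ U, -z ∈ resolventSet ℂ A ∧ ‖resolvent A (-z)‖ ≤ C / ‖z‖ := fun z hz => by
    have := hA (-z) (lt_abs_arg_neg hν₀ hν₀' (re_pos_of_mem_sector hγ0 hγ (hUsec z hz)))
    rwa [norm_neg] at this
  set F : ℂ → (X →L[ℂ] X) := fun z => φ (1 - z) • resolvent A (-z) with hF
  have hFdiff : DifferentiableOn ℂ F U := by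
    intro z hz
    have h1 : DifferentiableAt ℂ φ (1 - z) :=
      hφ1.1.differentiableAt ((isOpen_stolz γ).mem_nhds hz)
    have h2 : DifferentiableAt ℂ (fun z => φ (1 - z)) z :=
      DifferentiableAt.comp z h1 (by fun_prop)
    have h3 : DifferentiableAt ℂ (fun z => resolvent A (-z)) z :=
      DifferentiableAt.comp (g := resolvent A) (f := fun z : ℂ => -z) z
        (differentiableAt_resolvent (hres z hz).1) (by fun_prop)
    exact (h2.smul h3).differentiableWithinAt
  have hFb : ∀ z ∈ U, ‖F z‖ ≤ (c * C * (1 + 2 ^ (2 * s))) * decay s ‖z‖ := by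
    intro z hz
    have hz0 : 0 < ‖z‖ := norm_pos_iff.2 (hUsec z hz).1
    have hz2 : ‖z‖ ≤ 2 := by
      have h1 := hull_subset_closedBall γ (interior_subset hz)
      rw [mem_closedBall_zero_iff] at h1
      have h2 := norm_sub_le 1 (1 - z)
      rw [sub_sub_cancel, norm_one] at h2
      linarith
    have h1 := hφ2 (1 - z) hz
    rw [sub_sub_cancel] at h1
    have h2 : ‖z‖ ^ (2 * s) ≤ 2 ^ (2 * s) := Real.rpow_le_rpow hz0.le hz2 (by linarith)
    have h3 : ‖z‖ ^ (s - 1) ≤ (1 + 2 ^ (2 * s)) * decay s ‖z‖ := by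
      rw [decay, mul_div_assoc', le_div_iff₀ (by positivity), mul_comm]
      gcongr
    rw [hF, norm_smul]
    calc ‖φ (1 - z)‖ * ‖resolvent A (-z)‖ ≤ (c * ‖z‖ ^ s) * (C / ‖z‖) := by
          gcongr; exact (hres z hz).2
      _ = c * C * ‖z‖ ^ (s - 1) := by rw [Real.rpow_sub_one hz0.ne']; ring
      _ ≤ c * C * ((1 + 2 ^ (2 * s)) * decay s ‖z‖) := by gcongr
      _ = _ := by ring
  have hP := fun (z : ℂ) (hz : z ∈ U) => hasDerivAt_integral_ray_Ioc hUopen h0U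
    (fun t ht z hz => one_sub_smul_mem_stolz ht.1 ht.2 hz) hFdiff hs hFb hz
  set P : ℂ → (X →L[ℂ] X) := fun z => ∫ t in Ioc (0 : ℝ) 1, z • F (t * z) with hPdef
  have hPseg : ∀ v : ℂ, ∫ t in Ioc (0 : ℝ) (Real.cos β),
      (v * φ (1 - t * v)) • resolvent A (-(t * v)) = P ((Real.cos β : ℂ) * v) := by
    intro v
    have h1 := intervalIntegral.integral_comp_mul_right (a := 0) (b := 1)
      (fun t : ℝ => v • F (t * v)) hcβ.ne'
    rw [zero_mul, one_mul, eq_inv_smul_iff₀ hcβ.ne', ← intervalIntegral.integral_smul] at h1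
    rw [hPdef]
    simp only
    rw [← intervalIntegral.integral_of_le hcβ.le, ← intervalIntegral.integral_of_le zero_le_one]
    simp only [mul_smul]
    refine h1.symm.trans (intervalIntegral.integral_congr fun t _ => ?_)
    rw [Complex.ofReal_mul, mul_assoc]
    exact (Complex.coe_smul _ _).symm
  have hmem : ∀ v : ℂ, ‖v‖ = 1 → v.re = Real.cos β → (Real.cos β : ℂ) * v ∈ U := fun v hv hvre =>
    one_sub_ray_mem_stolz hβ hβγ hγ hv hvre ⟨hcβ, le_rfl⟩
  have hUconv : Convex ℝ U := by
    intro z hz z' hz' a b ha hb hab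
    have := convex_stolz γ hz hz' ha hb hab
    have e : a • (1 - z) + b • (1 - z') = 1 - (a • z + b • z') := by
      have : (a : ℂ) + b = 1 := by exact_mod_cast hab
      simp only [Complex.real_smul]
      linear_combination this
    rwa [e] at this
  set S := segment ℝ ((Real.cos β : ℂ) * y) ((Real.cos β : ℂ) * x)
  have hSU : S ⊆ U := hUconv.segment_subset (hmem y hy hyre) (hmem x hx hxre)
  have hSre : S ⊆ {z : ℂ | Real.cos β * Real.cos β ≤ z.re} := by
    refine (convex_halfSpace_re_ge _).segment_subset ?_ ?_
    · rw [mem_ofPred_eq, Complex.re_ofReal_mul, hyre]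
    · rw [mem_ofPred_eq, Complex.re_ofReal_mul, hxre]
  have hbound := (convex_segment (𝕜 := ℝ) ((Real.cos β : ℂ) * y)
    ((Real.cos β : ℂ) * x)).norm_image_sub_le_of_norm_hasDerivWithin_le (𝕜 := ℂ)
    (f := P) (f' := F) (C := M * (C / Real.cos γ ^ 2))
    (fun z hz => (hP z (hSU hz)).hasDerivWithinAt) (fun z hz => by
      have h1 : Real.cos γ ^ 2 ≤ ‖z‖ := by
        refine le_trans ?_ ((hSre hz).trans ((le_abs_self _).trans (Complex.abs_re_le_norm z)))
        rw [sq]; gcongr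
      rw [hF, norm_smul]
      refine mul_le_mul (norm_le_supNorm hφ1 (hSU hz)) ((hres z (hSU hz)).2.trans ?_)
        (norm_nonneg _) hM0
      gcongr)
    (left_mem_segment ℝ _ _) (right_mem_segment ℝ _ _)
  rw [hPseg, hPseg]
  refine hbound.trans ?_
  have h2 : ‖(Real.cos β : ℂ) * x - (Real.cos β : ℂ) * y‖ ≤ 2 := by
    refine (norm_sub_le _ _).trans ?_
    rw [norm_mul, norm_mul, hx, hy, Complex.norm_real, Real.norm_of_nonneg hcβ.le]
    linarith [Real.cos_le_one β]
  calc _ ≤ M * (C / Real.cos γ ^ 2) * 2 := by gcongr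
    _ = _ := by ring

end

/-! ### From the sector to the Stolz domain -/

section

variable {X : Type*} [NormedAddCommGroup X] [NormedSpace ℂ X] [CompleteSpace X]

/-- Along a segment of the contour, `resolvent A z` is the sum of `resolvent A z + resolvent A (-z)`,
whose integral is a value of the sectorial calculus, and of `-resolvent A (-z)`. -/
theorem integral_segment_eq {A : X →L[ℂ] X} {ν₀ ν θ α b M c s C : ℝ} {x : ℂ} {G : ℝ → ℂ}
    (h : IsRayDensity α x b M c s G)
    (hν₀ : 0 < ν₀) (hν₀ν : ν₀ < ν) (hνθ : ν < θ) (hθα : θ < α) (hα : α ≤ Real.pi / 2)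
    (hC : 0 ≤ C)
    (hA : ∀ z : ℂ, ν₀ < |z.arg| → z ∈ resolventSet ℂ A ∧ ‖resolvent A z‖ ≤ C / ‖z‖) :
    ∫ t in Ioc (0 : ℝ) b, (x * G t) • resolvent A (t * x) =
      sectorIntegral A ν (rayTransform x b G) -
        ∫ t in Ioc (0 : ℝ) b, (x * G t) • resolvent A (-(t * x)) := by
  have hres : ∀ u : ℝ → ℂ, (∀ t, 0 < t → ν₀ < |(u t).arg|) → Continuous u →
      (∀ t, 0 < t → ‖u t‖ = t) → IntegrableOn (fun t => (x * G t) • resolvent A (u t)) (Ioc 0 b) := by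
    intro u hu hucont hun
    have hcont : ContinuousOn (fun t => (x * G t) • resolvent A (u t)) (Ioc 0 b) := by
      refine (continuousOn_const.mul h.continuousOn).smul fun t ht => ?_
      exact (ContinuousAt.comp (g := resolvent A) (f := u)
        (differentiableAt_resolvent (hA _ (hu t ht.1)).1).continuousAt
        hucont.continuousAt).continuousWithinAt
    refine ((integrableOn_rpow_Ioc h.s_pos b).const_mul (|c| * C)).mono'
      (hcont.aestronglyMeasurable measurableSet_Ioc) ?_
    filter_upwards [ae_restrict_mem measurableSet_Ioc] with t ht
    have h2 := (hA _ (hu t ht.1)).2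
    rw [hun t ht.1] at h2
    have ht0 : 0 < t := ht.1
    rw [norm_smul, norm_mul, h.norm_eq, one_mul]
    calc ‖G t‖ * ‖resolvent A (u t)‖ ≤ (|c| * t ^ s) * (C / t) := by
          refine mul_le_mul ((h.norm_le_rpow t ht).trans ?_) h2 (norm_nonneg _) (by positivity)
          gcongr; exact le_abs_self c
      _ = |c| * C * t ^ (s - 1) := by rw [Real.rpow_sub_one ht0.ne']; ring
  have i1 := hres (fun t => t * x) (fun t ht => by linarith [(h.arg_mul_ge ht).1]) (by fun_prop)
    (fun t ht => h.norm_mul_ray ht)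
  have i2 := hres (fun t => -(t * x)) (fun t ht => by linarith [(h.arg_mul_ge ht).2]) (by fun_prop)
    (fun t ht => by rw [norm_neg, h.norm_mul_ray ht])
  rw [h.sectorIntegral_rayTransform hν₀ hν₀ν hνθ hθα hα hC hA]
  simp only [smul_add]
  rw [integral_add i1 i2, add_sub_cancel_right]

/-- Boundedness of the sectorial calculus of `1 - T` passes to the calculus of `T` on a larger Stolz
domain. -/
theorem exists_hasBoundedStolzCalculus {T : X →L[ℂ] X} (hT : IsRitt T) {θ : ℝ}
    (hθ : θ ∈ Ioo 0 (Real.pi / 2))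
    (h : HasBoundedSectorCalculus (ContinuousLinearMap.id ℂ X - T) θ) :
    ∃ γ ∈ Ioo (0 : ℝ) (Real.pi / 2), HasBoundedStolzCalculus T γ := by
  obtain ⟨ω, hω, hsec, K, hK, hcalc⟩ := h
  have hpi := Real.pi_pos
  set A := ContinuousLinearMap.id ℂ X - T with hAdef
  set ν₀ := ω + (θ - ω) / 3 with hν₀def
  set ν := ω + 2 * (θ - ω) / 3 with hνdef
  have hων₀ : ω < ν₀ := by rw [hν₀def]; linarith [hω.2]
  have hν₀ν : ν₀ < ν := by rw [hν₀def, hνdef]; linarith [hω.2]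
  have hνθ : ν < θ := by rw [hνdef]; linarith [hω.2]
  have hν₀ : 0 < ν₀ := hω.1.trans hων₀
  have hθ2 := hθ.2
  obtain ⟨C, hC, hA⟩ := hsec.exists_bound hω.1 hων₀ (by linarith)
  obtain ⟨α₀, ⟨hα₀1, hα₀2⟩, C₁, hT₁⟩ := hT.exists_stolz_bound hθ.1 hθ.2
    (fun z hz => hA z (by linarith))
  -- All contour angles `β ∈ (α, γ)` exceed `α > max α₀ θ`, and `γ < π / 2`; this makes the
  -- estimates below uniform in `β`.
  set α := (α₀ + Real.pi / 2) / 2 with hαdef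
  set γ := (α + Real.pi / 2) / 2 with hγdef
  have hα₀α : α₀ < α := by rw [hαdef]; linarith
  have hα2 : α < Real.pi / 2 := by rw [hαdef]; linarith
  have hαγ : α < γ := by rw [hγdef]; linarith
  have hγ2 : γ < Real.pi / 2 := by rw [hγdef]; linarith
  have hθα : θ < α := by linarith
  have hα0 : 0 < α := hθ.1.trans hθα
  have hα₀0 : 0 < α₀ := hθ.1.trans hα₀1
  have hout : ∀ β, α ≤ β → β ≤ Real.pi / 2 → ∀ z, z ∉ closure (stolz β) →
      z ∉ closure (stolz α₀) := fun β h1 h2 z hz hz' =>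
    hz (closure_mono (stolz_mono hα₀0.le (by linarith) h2) hz')
  refine ⟨γ, ⟨by linarith, hγ2⟩, α, ⟨hα0, hαγ⟩, ⟨fun z hz => ?_, fun β hβ =>
    ⟨C₁, fun z hz => (hT₁ z (hout β hβ.1.le hβ.2.le z hz)).2⟩⟩, ?_⟩
  · by_contra hc
    exact hz (hT₁ z (hout α le_rfl hα2.le z hc)).1
  set κ := 1 - Real.cos (α - θ) with hκdef
  have hκ : 0 < κ := one_sub_cos_pos (sub_pos.2 hθα) (by linarith [hθ.1])
  have hsinγ : Real.sin γ < 1 := by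
    rw [← Real.sin_pi_div_two]
    exact Real.sin_lt_sin_of_lt_of_le_pi_div_two (by linarith) le_rfl hγ2
  set q := ‖(2 * Real.pi * Complex.I : ℂ)⁻¹‖ with hq
  set K₁ := K * (Real.pi / κ) with hK₁
  set K₂ := 2 * (C / Real.cos γ ^ 2) with hK₂
  set K₃ := |C₁| / (1 - Real.sin γ) * (2 * Real.pi) with hK₃
  have hcγ : 0 < Real.cos γ := Real.cos_pos_of_mem_Ioo ⟨by linarith, hγ2⟩
  have hK₃0 : 0 ≤ K₃ := mul_nonneg (div_nonneg (abs_nonneg _) (by linarith)) (by linarith)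
  refine ⟨q * (K₁ + K₁ + K₂ + K₃) + 1, by positivity, fun φ hφ β hβ => ?_⟩
  obtain ⟨hβ1, hβ2⟩ := hβ
  set M := supNorm (stolz γ) φ with hM
  have hM0 : 0 ≤ M := supNorm_nonneg _ _
  have hβ0 : 0 < β := by linarith
  have hcβ : 0 < Real.cos β := Real.cos_pos_of_mem_Ioo ⟨by linarith, by linarith⟩
  have hsβ : 0 < Real.sin β := Real.sin_pos_of_pos_of_lt_pi hβ0 (by linarith)
  set w : ℂ := Complex.exp (β * Complex.I) with hw
  have hwn : ‖w‖ = 1 := Complex.norm_exp_ofReal_mul_I β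
  have hwn' : ‖starRingEnd ℂ w‖ = 1 := by rw [Complex.norm_conj, hwn]
  have hwre : w.re = Real.cos β := Complex.exp_ofReal_mul_I_re β
  have hwre' : (starRingEnd ℂ w).re = Real.cos β := by rw [Complex.conj_re, hwre]
  have hwarg : |w.arg| = β := by
    rw [hw, arg_exp_mul_I (by linarith) (by linarith), abs_of_pos hβ0]
  have hwarg' : |(starRingEnd ℂ w).arg| = β := by rw [abs_arg_conj, hwarg]
  obtain ⟨hφ1, s, c, hs, hc, hφ2⟩ := id hφ
  have hdens : ∀ x : ℂ, ‖x‖ = 1 → x.re = Real.cos β → |x.arg| = β →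
      IsRayDensity α x (Real.cos β) M c s (fun t => φ (1 - t * x)) := by
    intro x hx hxre hxarg
    have hmem : ∀ t ∈ Ioc 0 (Real.cos β), 1 - (t : ℂ) * x ∈ stolz γ := fun t ht =>
      one_sub_ray_mem_stolz hβ0 hβ2 hγ2 hx hxre ht
    refine ⟨hx, by rw [hxarg]; exact hβ1.le, (lt_abs_arg_neg hα0 hα2 (by rw [hxre]; exact hcβ)).le,
      hcβ.le, Real.cos_le_one β, hs, ?_,
      fun t ht => norm_le_supNorm hφ1 (hmem t ht), fun t ht => ?_⟩
    · exact hφ1.1.continuousOn.comp (f := fun t : ℝ => 1 - (t : ℂ) * x) (by fun_prop) hmem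
    · have h1 := hφ2 _ (hmem t ht)
      rwa [sub_sub_cancel, norm_mul, hx, mul_one, Complex.norm_real,
        Real.norm_of_nonneg ht.1.le] at h1
  have hsector : ∀ x : ℂ, ‖x‖ = 1 → x.re = Real.cos β → |x.arg| = β →
      ‖sectorIntegral A ν (rayTransform x (Real.cos β) (fun t => φ (1 - t * x)))‖ ≤ K₁ * M := by
    intro x hx hxre hxarg
    have hd := hdens x hx hxre hxarg
    refine (hcalc _ (hd.isHInftyZeroSector_rayTransform hθ.1 hθα hα2.le hM0) ν
      ⟨by linarith, hνθ⟩).trans ?_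
    rw [hK₁, mul_assoc]
    refine mul_le_mul_of_nonneg_left (supNorm_le (by positivity) fun z hz => ?_) hK.le
    exact hd.norm_rayTransform_le hθ.1 hθα hα2.le hM0 hz
  have harc : ‖∫ t in (Real.pi / 2 - β)..(3 * Real.pi / 2 + β),
      (Complex.I * (Real.sin β * Complex.exp (t * Complex.I)) *
        φ (Real.sin β * Complex.exp (t * Complex.I))) •
        resolvent T (Real.sin β * Complex.exp (t * Complex.I))‖ ≤ K₃ * M := by
    have hle : Real.pi / 2 - β ≤ 3 * Real.pi / 2 + β := by linarith
    refine (intervalIntegral.norm_integral_le_of_norm_le_const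
      (C := M * (|C₁| / (1 - Real.sin γ))) fun t ht => ?_).trans ?_
    · rw [uIoc_of_le hle] at ht
      have h1 := arc_notMem_closure_stolz hα₀0 (hα₀α.trans hβ1) (by linarith)
        (Ioc_subset_Icc_self ht)
      set z : ℂ := Real.sin β * Complex.exp (t * Complex.I) with hz
      have hzn : ‖z‖ = Real.sin β := by
        rw [hz, norm_mul, Complex.norm_exp_ofReal_mul_I, mul_one, Complex.norm_real,
          Real.norm_of_nonneg hsβ.le]
      have hlt : Real.sin β < Real.sin γ :=
        Real.sin_lt_sin_of_lt_of_le_pi_div_two (by linarith) hγ2.le hβ2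
      have h2 := norm_le_supNorm hφ1 (ball_subset_stolz γ
        (show z ∈ Metric.ball 0 (Real.sin γ) by rw [mem_ball_zero_iff, hzn]; exact hlt))
      have h3 := (hT₁ z h1).2
      have h4 : 1 - Real.sin γ ≤ ‖z - 1‖ := by
        have := norm_sub_norm_le 1 z
        rw [norm_one, norm_sub_rev, hzn] at this
        linarith
      have h5 : 0 < 1 - Real.sin γ := by linarith
      have h6 : ‖resolvent T z‖ ≤ |C₁| / (1 - Real.sin γ) := by
        rw [le_div_iff₀ h5, mul_comm]
        rw [norm_smul] at h3
        exact (mul_le_mul_of_nonneg_right h4 (norm_nonneg _)).trans (h3.trans (le_abs_self _))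
      rw [norm_smul, norm_mul, norm_mul, Complex.norm_I, one_mul]
      have h7 : ‖z‖ * ‖φ z‖ ≤ M := by
        refine (mul_le_of_le_one_left (norm_nonneg _) ?_).trans h2
        rw [hzn]; exact Real.sin_le_one β
      exact mul_le_mul h7 h6 (norm_nonneg _) hM0
    · have h8 : |3 * Real.pi / 2 + β - (Real.pi / 2 - β)| ≤ 2 * Real.pi := by
        rw [abs_of_nonneg (by linarith)]; linarith
      have h9 : 0 ≤ M * (|C₁| / (1 - Real.sin γ)) :=
        mul_nonneg hM0 (div_nonneg (abs_nonneg _) (by linarith))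
      refine (mul_le_mul_of_nonneg_left h8 h9).trans (le_of_eq ?_)
      rw [hK₃]; ring
  have hchord := norm_segment_sub_le (A := A) hν₀ (by linarith) hβ0 hβ2 hγ2 hC hA hφ hwn' hwn
    hwre' hwre
  rw [stolzIntegral_eq T hcβ.le, ← hw, ← hAdef,
    integral_segment_eq (hdens _ hwn hwre hwarg) hν₀ hν₀ν hνθ hθα hα2.le hC hA,
    integral_segment_eq (hdens _ hwn' hwre' hwarg') hν₀ hν₀ν hνθ hθα hα2.le hC hA,
    sub_sub_sub_comm, norm_smul, ← hq]
  have hs1 := hsector w hwn hwre hwarg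
  have hs2 := hsector _ hwn' hwre' hwarg'
  have hq0 : 0 ≤ q := norm_nonneg _
  calc _ ≤ q * (K₁ * M + K₁ * M + K₂ * M + K₃ * M) := by
        refine mul_le_mul_of_nonneg_left ((norm_add_le _ _).trans (add_le_add ?_ harc)) hq0
        refine (norm_sub_le _ _).trans (add_le_add ?_ hchord)
        exact (norm_sub_le _ _).trans (add_le_add hs2 hs1)
    _ = q * (K₁ + K₁ + K₂ + K₃) * M := by ring
    _ ≤ _ := mul_le_mul_of_nonneg_right (by linarith) hM0

end

/-! ### From the Stolz domain to the sector -/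

section

variable {X : Type*} [NormedAddCommGroup X] [NormedSpace ℂ X] {T : X →L[ℂ] X}

theorem mem_closure_sector {γ : ℝ} (h0 : 0 < γ) (h1 : γ < Real.pi / 2) {z : ℂ}
    (hz : 1 - z ∈ closure (stolz γ)) : z ∈ closure (sector γ) := by
  have := map_mem_closure (f := fun z : ℂ => 1 - z) (by fun_prop) hz
    (fun z hz => one_sub_mem_sector h0 h1 hz)
  rwa [sub_sub_cancel] at this

theorem IsRittOfType.isSectorialOfType {α : ℝ} (h : IsRittOfType T α) (h0 : 0 < α)
    (h1 : α < Real.pi / 2) : IsSectorialOfType (ContinuousLinearMap.id ℂ X - T) α := by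
  refine ⟨fun z hz => ?_, fun ν hν => ?_⟩
  · refine mem_closure_sector h0 h1 (h.1 fun hc => hz ?_)
    exact mem_resolventSet_one_sub.1 hc
  · set ν' := min ν ((α + Real.pi / 2) / 2) with hν'
    have h2 : α < ν' := lt_min hν.1 (by linarith)
    have h3 : ν' < Real.pi / 2 := (min_le_right _ _).trans_lt (by linarith)
    obtain ⟨C, hC⟩ := h.2 ν' ⟨h2, h3⟩
    refine ⟨C, fun z hz => ?_⟩
    have h4 : 1 - z ∉ closure (stolz ν') := fun hc =>
      hz (closure_mono (sector_mono (min_le_left _ _)) (mem_closure_sector (by linarith) h3 hc))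
    have h5 := hC _ h4
    rwa [resolvent_one_sub, sub_sub_cancel_left, neg_smul_neg] at h5

theorem IsHInftyZeroSector.comp_one_sub {γ : ℝ} (h0 : 0 < γ) (h1 : γ < Real.pi / 2) {f : ℂ → ℂ}
    (hf : IsHInftyZeroSector γ f) : IsHInftyZeroStolz γ (fun z => f (1 - z)) := by
  obtain ⟨⟨hd, M, hM⟩, s, c, hs, hc, hb⟩ := hf
  have hmaps : MapsTo (fun z : ℂ => 1 - z) (stolz γ) (sector γ) := fun z hz =>
    one_sub_mem_sector h0 h1 hz
  refine ⟨⟨hd.comp (by fun_prop) hmaps, M, fun z hz => hM _ (hmaps hz)⟩, s, c, hs, hc,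
    fun z hz => (hb _ (hmaps hz)).trans ?_⟩
  gcongr
  exact div_le_self (by positivity) (by linarith [Real.rpow_nonneg (norm_nonneg (1 - z)) (2 * s)])

theorem one_sub_arc_left (ν : ℝ) :
    1 - (Real.sin ν * Complex.exp (((Real.pi / 2 - ν : ℝ) : ℂ) * Complex.I) : ℂ) =
      Real.cos ν * starRingEnd ℂ (Complex.exp (ν * Complex.I)) := by
  apply Complex.ext
  · rw [Complex.sub_re, Complex.re_ofReal_mul, Complex.re_ofReal_mul, Complex.conj_re,
      Complex.exp_ofReal_mul_I_re, Complex.exp_ofReal_mul_I_re, Complex.one_re,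
      Real.cos_pi_div_two_sub]
    linear_combination -Real.sin_sq_add_cos_sq ν
  · rw [Complex.sub_im, Complex.im_ofReal_mul, Complex.im_ofReal_mul, Complex.conj_im,
      Complex.exp_ofReal_mul_I_im, Complex.exp_ofReal_mul_I_im, Complex.one_im,
      Real.sin_pi_div_two_sub]
    ring

theorem one_sub_arc_right (ν : ℝ) :
    1 - (Real.sin ν * Complex.exp (((3 * Real.pi / 2 + ν : ℝ) : ℂ) * Complex.I) : ℂ) =
      Real.cos ν * Complex.exp (ν * Complex.I) := by
  have h : 3 * Real.pi / 2 + ν = (ν + Real.pi / 2) + Real.pi := by ring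
  apply Complex.ext
  · rw [Complex.sub_re, Complex.re_ofReal_mul, Complex.re_ofReal_mul,
      Complex.exp_ofReal_mul_I_re, Complex.exp_ofReal_mul_I_re, Complex.one_re, h,
      Real.cos_add_pi, Real.cos_add_pi_div_two]
    linear_combination -Real.sin_sq_add_cos_sq ν
  · rw [Complex.sub_im, Complex.im_ofReal_mul, Complex.im_ofReal_mul,
      Complex.exp_ofReal_mul_I_im, Complex.exp_ofReal_mul_I_im, Complex.one_im, h,
      Real.sin_add_pi, Real.sin_add_pi_div_two]
    ring

theorem integral_arc_eq_sub {E : Type*} [NormedAddCommGroup E] [NormedSpace ℂ E] [CompleteSpace E]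
    {F Q : ℂ → E} {ν : ℝ} (hν : 0 < ν)
    (hQ : ∀ t ∈ Icc (Real.pi / 2 - ν) (3 * Real.pi / 2 + ν),
      HasDerivAt Q (-F (1 - Real.sin ν * Complex.exp (t * Complex.I)))
        (1 - Real.sin ν * Complex.exp (t * Complex.I)))
    (hF : ContinuousOn (fun t : ℝ => F (1 - Real.sin ν * Complex.exp (t * Complex.I)))
      (Icc (Real.pi / 2 - ν) (3 * Real.pi / 2 + ν))) :
    ∫ t in (Real.pi / 2 - ν)..(3 * Real.pi / 2 + ν),
      (Complex.I * (Real.sin ν * Complex.exp (t * Complex.I))) •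
        F (1 - Real.sin ν * Complex.exp (t * Complex.I)) =
      Q (Real.cos ν * Complex.exp (ν * Complex.I)) -
        Q (Real.cos ν * starRingEnd ℂ (Complex.exp (ν * Complex.I))) := by
  have hle : Real.pi / 2 - ν ≤ 3 * Real.pi / 2 + ν := by linarith [Real.pi_pos]
  have hderiv : ∀ t ∈ uIcc (Real.pi / 2 - ν) (3 * Real.pi / 2 + ν),
      HasDerivAt (fun t : ℝ => Q (1 - Real.sin ν * Complex.exp (t * Complex.I)))
        ((Complex.I * (Real.sin ν * Complex.exp (t * Complex.I))) •
          F (1 - Real.sin ν * Complex.exp (t * Complex.I))) t := by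
    intro t ht
    rw [uIcc_of_le hle] at ht
    have h5 : HasDerivAt (fun x : ℝ => (x : ℂ)) 1 t := Complex.ofRealCLM.hasDerivAt
    have h6 := (((h5.mul_const Complex.I).cexp).const_mul (Real.sin ν : ℂ)).const_sub 1
    have h7 := (hQ t ht).scomp t h6
    have e : -((Real.sin ν : ℂ) * (Complex.exp (t * Complex.I) * (1 * Complex.I))) •
          -F (1 - Real.sin ν * Complex.exp (t * Complex.I)) =
        (Complex.I * (Real.sin ν * Complex.exp (t * Complex.I))) •
          F (1 - Real.sin ν * Complex.exp (t * Complex.I)) := by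
      rw [neg_smul_neg]
      congr 1; ring
    rw [← e]
    exact h7
  rw [intervalIntegral.integral_eq_sub_of_hasDerivAt hderiv, one_sub_arc_right, one_sub_arc_left]
  refine ContinuousOn.intervalIntegrable ?_
  rw [uIcc_of_le hle]
  exact ContinuousOn.smul (Continuous.continuousOn (by fun_prop)) hF

/-- The sector contour may be deformed into the Stolz contour: the integrand has a primitive outside
a smaller Stolz domain, obtained by integration to infinity. -/
theorem sectorIntegral_eq_stolzIntegral [CompleteSpace X] {α ν γ : ℝ} (h : IsRittOfType T α)
    (h0 : 0 < α) (hαν : α < ν) (hνγ : ν < γ) (hγ : γ < Real.pi / 2) {f : ℂ → ℂ}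
    (hf : IsHInftyZeroSector γ f) :
    sectorIntegral (ContinuousLinearMap.id ℂ X - T) ν f =
      stolzIntegral T ν (fun z => f (1 - z)) := by
  have hpi := Real.pi_pos
  set A := ContinuousLinearMap.id ℂ X - T with hAdef
  set a := (α + ν) / 2 with ha
  have hαa : α < a := by linarith
  have haν : a < ν := by linarith
  have ha0 : 0 < a := by linarith
  have hν0 : 0 < ν := by linarith
  have hγ0 : 0 < γ := by linarith
  obtain ⟨C, hC⟩ := h.2 a ⟨hαa, by linarith⟩
  obtain ⟨⟨hd, -⟩, s, c, hs, hc, hb⟩ := hf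
  have hcν : 0 < Real.cos ν := Real.cos_pos_of_mem_Ioo ⟨by linarith, by linarith⟩
  set U : Set ℂ := sector γ ∩ {z | 1 - z ∉ closure (stolz a)} with hU
  have hUopen : IsOpen U := (isOpen_sector hγ0 (by linarith)).inter
    (isClosed_closure.isOpen_compl.preimage (f := fun z : ℂ => 1 - z) (by fun_prop))
  have h0U : (0 : ℂ) ∉ U := fun h => h.1.1 rfl
  have hres : ∀ z ∈ U, z ∈ resolventSet ℂ A ∧ ‖resolvent A z‖ ≤ C / ‖z‖ := by
    intro z hz
    refine ⟨?_, ?_⟩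
    · rw [← mem_resolventSet_one_sub]
      by_contra hcon
      exact hz.2 (closure_mono (stolz_mono h0.le hαa.le (by linarith)) (h.1 hcon))
    · have h1 := hC _ hz.2
      rw [resolvent_one_sub, sub_sub_cancel_left, neg_smul_neg, norm_smul] at h1
      rwa [le_div_iff₀ (norm_pos_iff.2 hz.1.1), mul_comm]
  have hUstar : ∀ t ∈ Ici (1 : ℝ), ∀ z ∈ U, (t : ℂ) * z ∈ U := by
    intro t ht z hz
    have ht0 : 0 < t := lt_of_lt_of_le one_pos ht
    refine ⟨smul_mem_sector ht0 hz.1, fun hcon => hz.2 ?_⟩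
    have h1 := (convex_stolz a).closure hcon (one_mem_closure_stolz ha0 (by linarith))
      (inv_nonneg.2 ht0.le) (sub_nonneg.2 (inv_le_one_of_one_le₀ ht)) (by ring)
    have ht0' : (t : ℂ) ≠ 0 := by exact_mod_cast ht0.ne'
    have e : t⁻¹ • (1 - (t : ℂ) * z) + (1 - t⁻¹) • (1 : ℂ) = 1 - z := by
      simp only [Complex.real_smul]
      push_cast
      field_simp
      ring
    rwa [e] at h1
  set F : ℂ → (X →L[ℂ] X) := fun z => f z • resolvent A z with hF
  have hFdiff : DifferentiableOn ℂ F U := fun z hz =>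
    (((hd z hz.1).differentiableAt ((isOpen_sector hγ0 (by linarith)).mem_nhds hz.1)).smul
      (differentiableAt_resolvent (hres z hz).1)).differentiableWithinAt
  have hFb : ∀ z ∈ U, ‖F z‖ ≤ (c * C) * decay s ‖z‖ := by
    intro z hz
    have hz0 : 0 < ‖z‖ := norm_pos_iff.2 hz.1.1
    rw [hF, norm_smul]
    calc ‖f z‖ * ‖resolvent A z‖ ≤ (c * (‖z‖ ^ s / (1 + ‖z‖ ^ (2 * s)))) * (C / ‖z‖) :=
          mul_le_mul (hb z hz.1) (hres z hz).2 (norm_nonneg _) (by positivity)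
      _ = _ := by rw [decay, Real.rpow_sub_one hz0.ne']; field_simp
  have hQ := fun (z : ℂ) (hz : z ∈ U) =>
    hasDerivAt_integral_ray_Ioi_one hUopen h0U hUstar hFdiff hs hFb hz
  set Q : ℂ → (X →L[ℂ] X) := fun z => ∫ t in Ioi (1 : ℝ), z • F (t * z) with hQdef
  set w : ℂ := Complex.exp (ν * Complex.I) with hw
  have hww' : Complex.exp (-(ν * Complex.I)) = starRingEnd ℂ w := by
    rw [hw, ← Complex.exp_conj]; simp
  have hwarg : |w.arg| = ν := by
    rw [hw, arg_exp_mul_I (by linarith) (by linarith), abs_of_pos hν0]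
  have hwarg' : |(starRingEnd ℂ w).arg| = ν := by rw [abs_arg_conj, hwarg]
  have hray : ∀ x : ℂ, |x.arg| = ν →
      ∫ t in Ioi (0 : ℝ), (x * f (t * x)) • resolvent A (t * x) =
        (∫ t in Ioc (0 : ℝ) (Real.cos ν), (x * f (t * x)) • resolvent A (t * x)) +
          Q ((Real.cos ν : ℂ) * x) := by
    intro x hx
    have hx0 : x ≠ 0 := by rintro rfl; simp at hx; linarith
    have hmem : ∀ t : ℝ, 0 < t → (t : ℂ) * x ∈ U := by
      intro t ht
      refine ⟨smul_mem_sector ht ⟨hx0, by rw [hx]; exact hνγ⟩, fun hcon => ?_⟩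
      have h1 := abs_arg_one_sub_le ha0 (by linarith) hcon
      rw [sub_sub_cancel, abs_arg_mul_ray ht, hx] at h1
      linarith
    have hint : IntegrableOn (fun t : ℝ => (x * f (t * x)) • resolvent A (t * x)) (Ioi 0) := by
      have := integrableOn_ray (F := F) hs hx0
        (fun t ht => (hFdiff.differentiableAt (hUopen.mem_nhds (hmem t ht))).continuousAt)
        (fun t ht => hFb _ (hmem t ht))
      simpa only [hF, smul_smul] using this
    have h1 := integral_comp_mul_right_Ioi (fun t : ℝ => x • F (t * x)) 1 hcν
    rw [one_mul, eq_inv_smul_iff₀ hcν.ne', ← integral_smul] at h1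
    rw [← Ioc_union_Ioi_eq_Ioi hcν.le, setIntegral_union Ioc_disjoint_Ioi_same measurableSet_Ioi
      (hint.mono_set Ioc_subset_Ioi_self) (hint.mono_set (Ioi_subset_Ioi hcν.le))]
    congr 1
    simp only [mul_smul]
    refine h1.symm.trans ?_
    rw [hQdef]
    refine setIntegral_congr_fun measurableSet_Ioi fun t _ => ?_
    rw [Complex.ofReal_mul, mul_assoc, mul_smul]
    exact (Complex.coe_smul _ _).symm
  have harc : ∫ t in (Real.pi / 2 - ν)..(3 * Real.pi / 2 + ν),
      (Complex.I * (Real.sin ν * Complex.exp (t * Complex.I)) *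
        f (1 - Real.sin ν * Complex.exp (t * Complex.I))) •
        resolvent T (Real.sin ν * Complex.exp (t * Complex.I)) =
      Q ((Real.cos ν : ℂ) * starRingEnd ℂ w) - Q ((Real.cos ν : ℂ) * w) := by
    have hmem : ∀ t ∈ Icc (Real.pi / 2 - ν) (3 * Real.pi / 2 + ν),
        1 - (Real.sin ν * Complex.exp (t * Complex.I) : ℂ) ∈ U := by
      intro t ht
      refine ⟨one_sub_mem_sector hγ0 hγ (ball_subset_stolz γ ?_), ?_⟩
      · rw [mem_ball_zero_iff, norm_mul, Complex.norm_exp_ofReal_mul_I, mul_one, Complex.norm_real,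
          Real.norm_of_nonneg (Real.sin_nonneg_of_nonneg_of_le_pi hν0.le (by linarith))]
        exact Real.sin_lt_sin_of_lt_of_le_pi_div_two (by linarith) hγ.le hνγ
      · rw [mem_ofPred_eq, sub_sub_cancel]
        exact arc_notMem_closure_stolz ha0 haν (by linarith) ht
    have h1 := integral_arc_eq_sub hν0 (fun t ht => hQ _ (hmem t ht)) (hFdiff.continuousOn.comp
      (f := fun t : ℝ => 1 - (Real.sin ν : ℂ) * Complex.exp (t * Complex.I)) (by fun_prop) hmem)
    rw [← hw] at h1
    rw [← neg_sub (Q (Real.cos ν * w)), ← h1, ← intervalIntegral.integral_neg]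
    refine intervalIntegral.integral_congr fun t _ => ?_
    have h8 := resolvent_one_sub T (1 - Real.sin ν * Complex.exp (t * Complex.I))
    rw [sub_sub_cancel, ← hAdef] at h8
    rw [h8, smul_neg, mul_smul]
  rw [stolzIntegral_eq T hcν.le, ← hw, ← hAdef, harc]
  simp only [sub_sub_cancel]
  unfold sectorIntegral
  simp only
  rw [← hw, hww', hray _ hwarg, hray _ hwarg', add_sub_add_comm]

/-- Boundedness of the calculus of `T` on a Stolz domain passes to the sectorial calculus of
`1 - T`, by the substitution `φ(z) = f(1 - z)`. -/
theorem HasBoundedStolzCalculus.hasBoundedSectorCalculus [CompleteSpace X] {γ : ℝ}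
    (hγ : γ ∈ Ioo 0 (Real.pi / 2)) (h : HasBoundedStolzCalculus T γ) :
    HasBoundedSectorCalculus (ContinuousLinearMap.id ℂ X - T) γ := by
  obtain ⟨α, hα, hT, K, hK, hcalc⟩ := h
  refine ⟨α, hα, hT.isSectorialOfType hα.1 (hα.2.trans hγ.2), K, hK, fun f hf ν hν => ?_⟩
  rw [sectorIntegral_eq_stolzIntegral hT hα.1 hν.1 hν.2 hγ.2 hf]
  refine (hcalc _ (hf.comp_one_sub hγ.1 hγ.2) ν hν).trans (mul_le_mul_of_nonneg_left ?_ hK.le)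
  exact supNorm_le (supNorm_nonneg _ _) fun z hz =>
    norm_le_supNorm hf.1 (one_sub_mem_sector hγ.1 hγ.2 hz)

end

end RittCalculus


theorem proposition4p1 {X : Type*} [NormedAddCommGroup X] [NormedSpace ℂ X] [CompleteSpace X]
    (T : X →L[ℂ] X) (hT : RittCalculus.IsRitt T) :
    (∃ γ ∈ Set.Ioo (0 : ℝ) (Real.pi / 2), RittCalculus.HasBoundedStolzCalculus T γ) ↔
      ∃ θ ∈ Set.Ioo (0 : ℝ) (Real.pi / 2),
        RittCalculus.HasBoundedSectorCalculus (ContinuousLinearMap.id ℂ X - T) θ := by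
  constructor
  · rintro ⟨γ, hγ, h⟩
    exact ⟨γ, hγ, h.hasBoundedSectorCalculus hγ⟩
  · rintro ⟨θ, hθ, h⟩
    exact RittCalculus.exists_hasBoundedStolzCalculus hT hθ h
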